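/- Let $K$ be a field with $\mathrm{char}(K)\neq 2$ and let $(V,c)$ be a two-dimensional braided vector space over $K$, i.e. $c:V\otimes V\to V\otimes V$ is a $K$-linear map (not necessarily invertible) with $c_1c_2c_1=c_2c_1c_2$ on $V^{\otimes 3}$, where $c_1=c\otimes \mathrm{Id}_V$ and $c_2=\mathrm{Id}_V\otimes c$. Put $E_2(V,c)=\ker(c+\mathrm{Id}_{V^{\otimes2}})$ and let $S_Q(V,c)=T(V)/(E_2(V,c))$ be the quadratic symmetric algebra. Let $\mathcal B(V,c)=\mathrm{Im}(\Gamma)\cong T(V)/\ker\Gamma$ be the Nichols algebra, where $\Gamma:T(V)\to T^c(V,c)$ is the algebra homomorphism to the quantum shuffle algebra with $\Gamma|_V=\mathrm{Id}_V$. We write $S_Q(V,c)=\mathcal B(V,c)$ if these two quotients of $T(V)$ coincide, i.e. $(E_2(V,c))=\ker\Gamma$. Suppose that, for some basis $x_1,x_2$ of $V$ and some $\gamma\in K$, the matrix of $c$ with respect to the ordered basis $x_1\otimes x_1,\ x_2\otimes x_1,\ x_1\otimes x_2,\ x_2\otimes x_2$ (the columns being the coordinates of the images of the basis vectors) is one of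 the following: 1. $\begin{pmatrix}1&0&0&0\\0&0&1&0\\0&1&0&0\\0&0&0&1\end{pmatrix}$; 2. $\begin{pmatrix}1&1&-1&0\\0&0&1&0\\0&1&0&0\\0&0&0&1\end{pmatrix}$; 3. $\begin{pmatrix}-1&0&0&\gamma\\0&0&1&0\\0&1&0&0\\0&0&0&1\end{pmatrix}$, where $\gamma=0$, or $\gamma=1$, or $\gamma$ is not a square in $K$; 4. $\begin{pmatrix}1&0&0&\gamma\\0&0&1&0\\0&1&0&0\\0&0&0&-1\end{pmatrix}$, where $\gamma=0$, or $\gamma=1$, or $\gamma$ is not a square in $K$; 5. $\begin{pmatrix}0&1&0&0\\0&0&1&0\\0&1&0&0\\0&0&0&1\end{pmatrix}$; 6. $\begin{pmatrix}0&0&0&0\\0&0&\gamma&0\\0&\gamma^{-1}&0&0\\0&0&0&1\end{pmatrix}$, where $\gamma\neq0,1$; 7. $\begin{pmatrix}\gamma&0&0&0\\0&0&1&0\\0&1&0&0\\0&0&0&1\end{pmatrix}$, where $\gamma\neq\pm1$; 8. $\begin{pmatrix}1&0&0&\gamma\\0&0&1&0\\0&1&0&0\\0&0&0&1\end{pmatrix}$,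 where $\gamma=1$ or $\gamma$ is not a square in $K$. Then: - in all cases except case 7, $S_Q(V,c)=\mathcal B(V,c)$ if and only if $\mathrm{char}(K)=0$; - in case 7, $S_Q(V,c)=\mathcal B(V,c)$ if and only if $\mathrm{char}(K)=0$ and $\gamma$ is not a root of unity. -/

import Mathlib

open scoped TensorProduct

universe u v

/-- A braided vector space structure on `V`: a linear endomorphism `c` of `V ⊗ V` (not assumed to
be invertible) with `c₁ c₂ c₁ = c₂ c₁ c₂` on `V ⊗ V ⊗ V`. -/
structure Braiding (K : Type u) (V : Type v) [Field K] [AddCommGroup V] [Module K V] where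
  toLin : V ⊗[K] V →ₗ[K] V ⊗[K] V
  yang_baxter :
    let c₁ : (V ⊗[K] V) ⊗[K] V →ₗ[K] (V ⊗[K] V) ⊗[K] V := toLin.rTensor V
    let c₂ : (V ⊗[K] V) ⊗[K] V →ₗ[K] (V ⊗[K] V) ⊗[K] V :=
      (TensorProduct.assoc K V V V).symm.toLinearMap ∘ₗ toLin.lTensor V ∘ₗ
        (TensorProduct.assoc K V V V).toLinearMap
    c₁ ∘ₗ c₂ ∘ₗ c₁ = c₂ ∘ₗ c₁ ∘ₗ c₂

/-! ### Sums of quantum shuffles in a ring with elements satisfying the braid relations -/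

namespace BraidShuffle

variable {R : Type u} [Ring R] (σ : ℕ → R)

/-- `σ_k σ_{k+1} ⋯ σ_{k+n-1}`. -/
def chain : ℕ → ℕ → R
  | _, 0 => 1
  | k, n + 1 => σ k * chain (k + 1) n

/-- The sum of the lifts of the `(p, q)`-shuffles of the positions `k, …, k + p + q - 1`.
Either the first of the `p` letters comes first, or the first of the `q` letters is moved to the
front, past the `p` letters, by means of the braiding. -/
def shuffle (k p q : ℕ) : R :=
  match p, q with
  | 0, _ => 1
  | _ + 1, 0 => 1
  | p + 1, q + 1 => shuffle (k + 1) p (q + 1) + shuffle (k + 1) (p + 1) q * chain σ k (p + 1)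
termination_by p + q

theorem shuffle_zero_left (k q : ℕ) : shuffle σ k 0 q = 1 := by
  rw [shuffle]

theorem shuffle_zero_right (k p : ℕ) : shuffle σ k p 0 = 1 := by
  cases p <;> rw [shuffle]

theorem shuffle_succ (k p q : ℕ) : shuffle σ k (p + 1) (q + 1) =
    shuffle σ (k + 1) p (q + 1) + shuffle σ (k + 1) (p + 1) q * chain σ k (p + 1) := by
  rw [shuffle]

theorem chain_add (k m n : ℕ) : chain σ k (m + n) = chain σ k m * chain σ (k + m) n := by
  induction m generalizing k with
  | zero => simp [chain]
  | succ m ih =>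
    rw [show m + 1 + n = (m + n) + 1 by omega, chain, chain, ih, mul_assoc,
      show k + 1 + m = k + (m + 1) by omega]

theorem chain_commute (a : R) (k n : ℕ) (h : ∀ j, k ≤ j → j < k + n → Commute a (σ j)) :
    Commute a (chain σ k n) := by
  induction n generalizing k with
  | zero => exact Commute.one_right a
  | succ n ih =>
    rw [chain]
    exact (h k le_rfl (by omega)).mul_right (ih (k + 1) fun j h1 h2 => h j (by omega) (by omega))

theorem shuffle_commute (a : R) (k p q : ℕ) (h : ∀ j, k ≤ j → Commute a (σ j)) :
    Commute a (shuffle σ k p q) := by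
  induction hn : p + q generalizing k p q with
  | zero =>
    obtain rfl : p = 0 := by omega
    rw [shuffle_zero_left]; exact Commute.one_right a
  | succ n ih =>
    rcases p with _ | p
    · rw [shuffle_zero_left]; exact Commute.one_right a
    rcases q with _ | q
    · rw [shuffle_zero_right]; exact Commute.one_right a
    rw [shuffle_succ]
    exact (ih (k + 1) p (q + 1) (fun j hj => h j (by omega)) (by omega)).add_right
      ((ih (k + 1) (p + 1) q (fun j hj => h j (by omega)) (by omega)).mul_right
        (chain_commute σ a k (p + 1) fun j hj _ => h j hj))

theorem shuffle_rel {S : Type v} [Ring S] (τ : ℕ → S) (Q : R → S → Prop) (h1 : Q 1 1)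
    (hadd : ∀ a b a' b', Q a b → Q a' b' → Q (a + a') (b + b'))
    (hmul : ∀ a b a' b', Q a b → Q a' b' → Q (a * a') (b * b')) (m k p q : ℕ)
    (h : ∀ j, k ≤ j → j + 1 < k + p + q → Q (σ (m + j)) (τ j)) :
    Q (shuffle σ (m + k) p q) (shuffle τ k p q) := by
  have hchain : ∀ n k, (∀ j, k ≤ j → j < k + n → Q (σ (m + j)) (τ j)) →
      Q (chain σ (m + k) n) (chain τ k n) := by
    intro n
    induction n with
    | zero => intro k _; exact h1
    | succ n ih =>
      intro k h
      exact hmul _ _ _ _ (h k le_rfl (by omega)) (ih (k + 1) fun j h2 h3 =>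
        h j (by omega) (by omega))
  induction hn : p + q generalizing k p q with
  | zero =>
    obtain rfl : p = 0 := by omega
    rw [shuffle_zero_left, shuffle_zero_left]; exact h1
  | succ n ih =>
    rcases p with _ | p
    · rw [shuffle_zero_left, shuffle_zero_left]; exact h1
    rcases q with _ | q
    · rw [shuffle_zero_right, shuffle_zero_right]; exact h1
    rw [shuffle_succ, shuffle_succ]
    exact hadd _ _ _ _
      (ih (k + 1) p (q + 1) (fun j _ _ => h j (by omega) (by omega)) (by omega))
      (hmul _ _ _ _ (ih (k + 1) (p + 1) q (fun j _ _ => h j (by omega) (by omega)) (by omega))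
        (hchain _ _ fun j _ _ => h j (by omega) (by omega)))

variable {σ}

theorem chain_mul (hb : ∀ i, σ i * σ (i + 1) * σ i = σ (i + 1) * σ i * σ (i + 1))
    (hc : ∀ i j, i + 2 ≤ j → Commute (σ i) (σ j)) (k n i : ℕ) (h1 : k ≤ i) (h2 : i + 1 < k + n) :
    chain σ k n * σ i = σ (i + 1) * chain σ k n := by
  induction n generalizing k with
  | zero => omega
  | succ n ih =>
    rcases Nat.eq_or_lt_of_le h1 with rfl | h
    · obtain ⟨m, rfl⟩ : ∃ m, n = m + 1 := ⟨n - 1, by omega⟩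
      have e : Commute (σ k) (chain σ (k + 1 + 1) m) :=
        chain_commute σ _ _ _ fun j hj _ => hc k j (by omega)
      rw [chain, chain]
      calc σ k * (σ (k + 1) * chain σ (k + 1 + 1) m) * σ k
          = σ k * σ (k + 1) * (chain σ (k + 1 + 1) m * σ k) := by simp only [mul_assoc]
        _ = σ k * σ (k + 1) * σ k * chain σ (k + 1 + 1) m := by
          rw [← e.eq]; simp only [mul_assoc]
        _ = _ := by rw [hb]; simp only [mul_assoc]
    · rw [chain, mul_assoc, ih (k + 1) h (by omega), ← mul_assoc, ← mul_assoc,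
        (hc k (i + 1) (by omega)).eq]

theorem chain_mul_chain (hb : ∀ i, σ i * σ (i + 1) * σ i = σ (i + 1) * σ i * σ (i + 1))
    (hc : ∀ i j, i + 2 ≤ j → Commute (σ i) (σ j)) (k n i m : ℕ) (h1 : k ≤ i)
    (h2 : i + m < k + n) :
    chain σ k n * chain σ i m = chain σ (i + 1) m * chain σ k n := by
  induction m generalizing i with
  | zero => simp [chain]
  | succ m ih =>
    rw [chain, chain, ← mul_assoc, chain_mul hb hc k n i h1 (by omega), mul_assoc,
      ih (i + 1) (by omega) (by omega), mul_assoc]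

theorem chain_mul_shuffle (hb : ∀ i, σ i * σ (i + 1) * σ i = σ (i + 1) * σ i * σ (i + 1))
    (hc : ∀ i j, i + 2 ≤ j → Commute (σ i) (σ j)) (k n i p q : ℕ) (h1 : k ≤ i)
    (h2 : i + p + q ≤ k + n) :
    chain σ k n * shuffle σ i p q = shuffle σ (i + 1) p q * chain σ k n := by
  induction hn : p + q generalizing i p q with
  | zero =>
    obtain rfl : p = 0 := by omega
    simp [shuffle_zero_left]
  | succ m ih =>
    rcases p with _ | p
    · simp [shuffle_zero_left]
    rcases q with _ | q
    · simp [shuffle_zero_right]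
    rw [shuffle_succ, shuffle_succ, mul_add, add_mul, ih (i + 1) p (q + 1) (by omega) (by omega)
      (by omega), ← mul_assoc, ih (i + 1) (p + 1) q (by omega) (by omega) (by omega), mul_assoc,
      chain_mul_chain hb hc k n i (p + 1) h1 (by omega), mul_assoc]

theorem shuffle_assoc (hb : ∀ i, σ i * σ (i + 1) * σ i = σ (i + 1) * σ i * σ (i + 1))
    (hc : ∀ i j, i + 2 ≤ j → Commute (σ i) (σ j)) (k p q r : ℕ) :
    shuffle σ k (p + q) r * shuffle σ k p q =
      shuffle σ k p (q + r) * shuffle σ (k + p) q r := by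
  induction hn : p + q + r generalizing k p q r with
  | zero =>
    obtain rfl : p = 0 := by omega
    obtain rfl : q = 0 := by omega
    simp [shuffle_zero_left]
  | succ m ih =>
    rcases p with _ | p
    · simp [shuffle_zero_left]
    rcases q with _ | q
    · simp [shuffle_zero_left, shuffle_zero_right]
    rcases r with _ | r
    · simp [shuffle_zero_right]
    have i1 := ih (k + 1) p (q + 1) (r + 1) (by omega)
    have i2 := ih (k + 1) (p + 1) q (r + 1) (by omega)
    have i3 := ih (k + 1) (p + 1) (q + 1) r (by omega)
    have e1 : chain σ k (p + 1 + (q + 1)) * shuffle σ k (p + 1) (q + 1) =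
        shuffle σ (k + 1) (p + 1) (q + 1) * chain σ k (p + 1 + (q + 1)) :=
      chain_mul_shuffle hb hc _ _ _ _ _ le_rfl (by omega)
    have e2 : Commute (chain σ k (p + 1)) (shuffle σ (k + (p + 1) + 1) q (r + 1)) :=
      shuffle_commute σ _ _ _ _ fun j hj =>
        (chain_commute σ _ _ _ fun l _ h2 => (hc l j (by omega)).symm).symm
    have e3 : Commute (chain σ k (p + 1)) (shuffle σ (k + (p + 1) + 1) (q + 1) r) :=
      shuffle_commute σ _ _ _ _ fun j hj =>
        (chain_commute σ _ _ _ fun l _ h2 => (hc l j (by omega)).symm).symm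
    have e4 := chain_add σ k (p + 1) (q + 1)
    rw [show p + 1 + (q + 1) = p + q + 1 + 1 by omega] at *
    rw [show p + (q + 1) = p + q + 1 by omega, show q + 1 + (r + 1) = q + r + 1 + 1 by omega,
      show k + 1 + p = k + (p + 1) by omega] at i1
    rw [show p + 1 + q = p + q + 1 by omega, show q + (r + 1) = q + r + 1 by omega,
      show k + 1 + (p + 1) = k + (p + 1) + 1 by omega] at i2
    rw [show q + 1 + r = q + r + 1 by omega,
      show k + 1 + (p + 1) = k + (p + 1) + 1 by omega] at i3
    rw [shuffle_succ σ k (p + q + 1) r, add_mul, mul_assoc, e1, ← mul_assoc, i3,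
      shuffle_succ σ k p q, mul_add, i1, ← mul_assoc, i2,
      show q + 1 + (r + 1) = q + r + 1 + 1 by omega, shuffle_succ σ k p (q + r + 1), add_mul,
      shuffle_succ σ (k + (p + 1)) q r, mul_add, mul_add, add_assoc, e4]
    congr 1
    simp only [mul_assoc]
    rw [e2.eq, ← mul_assoc (chain σ k (p + 1)), e3.eq]
    simp only [mul_assoc]

end BraidShuffle

/-! ### The action of the braiding on the tensor algebra -/

namespace Braiding

open TensorProduct BraidShuffle

section Letters

variable (K : Type u) (V : Type v) [Field K] [AddCommGroup V] [Module K V]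

/-- `x ⊗ t ↦ x t`, for `x` in `V` and `t` in the tensor algebra. -/
noncomputable def cons : V ⊗[K] TensorAlgebra K V →ₗ[K] TensorAlgebra K V :=
  TensorProduct.lift ((LinearMap.mul K (TensorAlgebra K V)).comp (TensorAlgebra.ι K))

/-- Auxiliary operator `(s, z) ↦ (x s, x ⊗ s)`, used to split off the first letter. -/
noncomputable def unconsStep :
    V →ₗ[K] Module.End K (TensorAlgebra K V × (V ⊗[K] TensorAlgebra K V)) :=
  LinearMap.mk₂ K (fun x s => (TensorAlgebra.ι K x * s.1, x ⊗ₜ[K] s.1))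
    (fun _ _ _ => by simp [add_mul, TensorProduct.add_tmul])
    (fun _ _ _ => by simp [TensorProduct.smul_tmul'])
    (fun _ _ _ => by simp [mul_add, TensorProduct.tmul_add])
    (fun _ _ _ => by simp)

/-- Splitting off the first letter: `x t ↦ x ⊗ t` and `1 ↦ 0`. -/
noncomputable def uncons : TensorAlgebra K V →ₗ[K] V ⊗[K] TensorAlgebra K V where
  toFun t := (TensorAlgebra.lift K (unconsStep K V) t (1, 0)).2
  map_add' _ _ := by simp
  map_smul' _ _ := by simp

variable {K V}

theorem cons_tmul (x : V) (t : TensorAlgebra K V) :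
    cons K V (x ⊗ₜ t) = TensorAlgebra.ι K x * t := rfl

theorem unconsStep_apply (x : V) (s : TensorAlgebra K V × (V ⊗[K] TensorAlgebra K V)) :
    unconsStep K V x s = (TensorAlgebra.ι K x * s.1, x ⊗ₜ[K] s.1) := rfl

theorem unconsStep_fst (t : TensorAlgebra K V)
    (s : TensorAlgebra K V × (V ⊗[K] TensorAlgebra K V)) :
    (TensorAlgebra.lift K (unconsStep K V) t s).1 = t * s.1 := by
  induction t using TensorAlgebra.induction generalizing s with
  | algebraMap r => simp [Algebra.smul_def]
  | ι x => simp [unconsStep_apply]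
  | mul a b ha hb => simp [ha, hb, mul_assoc]
  | add a b ha hb => simp [ha, hb, add_mul]

@[simp] theorem uncons_one : uncons K V 1 = 0 := by simp [uncons]

@[simp] theorem uncons_ι_mul (x : V) (t : TensorAlgebra K V) :
    uncons K V (TensorAlgebra.ι K x * t) = x ⊗ₜ t := by
  have h := unconsStep_fst t ((1 : TensorAlgebra K V), 0)
  rw [mul_one] at h
  conv_rhs => rw [← h]
  simp [uncons, unconsStep_apply]

theorem induction_left {P : TensorAlgebra K V → Prop} (h1 : P 1)
    (hs : ∀ (r : K) a, P a → P (r • a)) (hadd : ∀ a b, P a → P b → P (a + b))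
    (hι : ∀ x t, P t → P (TensorAlgebra.ι K x * t)) (t : TensorAlgebra K V) : P t := by
  suffices h : ∀ s, P s → P (t * s) by simpa using h 1 h1
  induction t using TensorAlgebra.induction with
  | algebraMap r => intro s h; rw [← Algebra.smul_def]; exact hs r s h
  | ι x => exact hι x
  | mul a b ha hb => intro s h; rw [mul_assoc]; exact ha _ (hb _ h)
  | add a b ha hb => intro s h; rw [add_mul]; exact hadd _ _ (ha _ h) (hb _ h)

theorem end_ext {f g : Module.End K (TensorAlgebra K V)} (h1 : f 1 = g 1)
    (h : ∀ x t, f (TensorAlgebra.ι K x * t) = g (TensorAlgebra.ι K x * t)) : f = g := by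
  ext1 t
  induction t using induction_left with
  | h1 => exact h1
  | hs r a ha => rw [map_smul, map_smul, ha]
  | hadd a b ha hb => rw [map_add, map_add, ha, hb]
  | hι x t _ => exact h x t

variable (K V) in
/-- The operator `x t ↦ x f(t)`, `1 ↦ 0`. -/
noncomputable def shift (f : Module.End K (TensorAlgebra K V)) :
    Module.End K (TensorAlgebra K V) :=
  cons K V ∘ₗ f.lTensor V ∘ₗ uncons K V

@[simp] theorem shift_one (f : Module.End K (TensorAlgebra K V)) : shift K V f 1 = 0 := by
  simp [shift]

@[simp] theorem shift_ι_mul (f : Module.End K (TensorAlgebra K V)) (x : V)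
    (t : TensorAlgebra K V) :
    shift K V f (TensorAlgebra.ι K x * t) = TensorAlgebra.ι K x * f t := by
  simp [shift, cons_tmul]

theorem shift_mul (f g : Module.End K (TensorAlgebra K V)) :
    shift K V f * shift K V g = shift K V (f * g) :=
  end_ext (by simp) (fun x t => by simp)

end Letters

variable {K : Type u} {V : Type v} [Field K] [AddCommGroup V] [Module K V] (c : Braiding K V)

/-- The braiding applied to the first two letters: `x y t ↦ c(x ⊗ y) t`; words with fewer than two
letters are sent to `0`. -/
noncomputable def headBraid : Module.End K (TensorAlgebra K V) :=
  cons K V ∘ₗ (cons K V).lTensor V ∘ₗ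
    (TensorProduct.assoc K V V (TensorAlgebra K V)).toLinearMap ∘ₗ
    c.toLin.rTensor (TensorAlgebra K V) ∘ₗ
    (TensorProduct.assoc K V V (TensorAlgebra K V)).symm.toLinearMap ∘ₗ
    (uncons K V).lTensor V ∘ₗ uncons K V

/-- The braiding applied to the letters number `i` and `i + 1`, counted from `0`; words with
fewer than `i + 2` letters are sent to `0`. -/
noncomputable def act : ℕ → Module.End K (TensorAlgebra K V)
  | 0 => c.headBraid
  | i + 1 => shift K V (act i)

variable (K V) in
/-- `x ⊗ y ↦ x y t`. -/
noncomputable def two (t : TensorAlgebra K V) : V ⊗[K] V →ₗ[K] TensorAlgebra K V :=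
  cons K V ∘ₗ (cons K V).lTensor V ∘ₗ (TensorProduct.assoc K V V _).toLinearMap ∘ₗ
    (TensorProduct.mk K (V ⊗[K] V) (TensorAlgebra K V)).flip t

theorem two_tmul (t : TensorAlgebra K V) (x y : V) :
    two K V t (x ⊗ₜ y) = TensorAlgebra.ι K x * (TensorAlgebra.ι K y * t) := by
  simp [two, cons_tmul]

theorem headBraid_two (t : TensorAlgebra K V) (z : V ⊗[K] V) :
    c.headBraid (two K V t z) = two K V t (c.toLin z) := by
  induction z using TensorProduct.induction_on with
  | zero => simp
  | add a b ha hb => simp only [map_add, ha, hb]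
  | tmul x y => rw [two_tmul]; simp [headBraid, two]

@[simp] theorem headBraid_one : c.headBraid 1 = 0 := by simp [headBraid]

@[simp] theorem headBraid_ι_mul_one (x : V) :
    c.headBraid (TensorAlgebra.ι K x * 1) = 0 := by
  simp only [headBraid, LinearMap.comp_apply, uncons_ι_mul, LinearMap.lTensor_tmul, uncons_one,
    TensorProduct.tmul_zero, map_zero]

theorem headBraid_ι_mul_ι_mul (x y : V) (t : TensorAlgebra K V) :
    c.headBraid (TensorAlgebra.ι K x * (TensorAlgebra.ι K y * t)) =
      two K V t (c.toLin (x ⊗ₜ y)) := by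
  rw [← two_tmul, headBraid_two]

theorem two_mul (t s : TensorAlgebra K V) (z : V ⊗[K] V) :
    two K V t z * s = two K V (t * s) z := by
  induction z using TensorProduct.induction_on with
  | zero => simp
  | add a b ha hb => simp only [map_add, add_mul, ha, hb]
  | tmul x y => simp only [two_tmul, mul_assoc]

theorem shift_shift_two (f : Module.End K (TensorAlgebra K V)) (t : TensorAlgebra K V)
    (z : V ⊗[K] V) : shift K V (shift K V f) (two K V t z) = two K V (f t) z := by
  induction z using TensorProduct.induction_on with
  | zero => simp
  | add a b ha hb => simp only [map_add, ha, hb]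
  | tmul x y => simp only [two_tmul, shift_ι_mul]

theorem headBraid_far (f : Module.End K (TensorAlgebra K V)) :
    Commute c.headBraid (shift K V (shift K V f)) := by
  refine end_ext (by simp) fun x t => ?_
  revert x
  induction t using induction_left with
  | h1 => intro x; simp only [Module.End.mul_apply, shift_ι_mul, shift_one, mul_zero, map_zero,
      headBraid_ι_mul_one]
  | hs r a ha => intro x; simp only [mul_smul_comm, map_smul, ha]
  | hadd a b ha hb => intro x; simp only [mul_add, map_add, ha, hb]
  | hι y t _ =>
    intro x
    simp only [Module.End.mul_apply, shift_ι_mul, headBraid_ι_mul_ι_mul, shift_shift_two]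

theorem act_far (i j : ℕ) (h : i + 2 ≤ j) : Commute (c.act i) (c.act j) := by
  induction i generalizing j with
  | zero =>
    obtain ⟨j, rfl⟩ : ∃ k, j = k + 2 := ⟨j - 2, by omega⟩
    exact c.headBraid_far _
  | succ i ih =>
    obtain ⟨j, rfl⟩ : ∃ k, j = k + 1 := ⟨j - 1, by omega⟩
    have := ih j (by omega)
    simp only [act, Commute, SemiconjBy, shift_mul] at this ⊢
    rw [this]

variable (K V) in
/-- `(x ⊗ y) ⊗ z ↦ x y z t`. -/
noncomputable def three (t : TensorAlgebra K V) :
    (V ⊗[K] V) ⊗[K] V →ₗ[K] TensorAlgebra K V :=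
  cons K V ∘ₗ (two K V t).lTensor V ∘ₗ (TensorProduct.assoc K V V V).toLinearMap

theorem three_tmul (t : TensorAlgebra K V) (z : V ⊗[K] V) (y : V) :
    three K V t (z ⊗ₜ y) = two K V (TensorAlgebra.ι K y * t) z := by
  induction z using TensorProduct.induction_on with
  | zero => simp
  | add a b ha hb => simp only [map_add, TensorProduct.add_tmul, ha, hb]
  | tmul x y => simp [three, two_tmul, cons_tmul]

theorem act_zero_three (t : TensorAlgebra K V) (z : (V ⊗[K] V) ⊗[K] V) :
    c.act 0 (three K V t z) = three K V t (c.toLin.rTensor V z) := by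
  induction z using TensorProduct.induction_on with
  | zero => simp
  | add a b ha hb => simp only [map_add, ha, hb]
  | tmul x y => simp only [three_tmul, LinearMap.rTensor_tmul, act, headBraid_two]

theorem act_one_three (t : TensorAlgebra K V) (z : (V ⊗[K] V) ⊗[K] V) :
    c.act 1 (three K V t z) = three K V t
      (((TensorProduct.assoc K V V V).symm.toLinearMap ∘ₗ c.toLin.lTensor V ∘ₗ
        (TensorProduct.assoc K V V V).toLinearMap) z) := by
  obtain ⟨z, rfl⟩ := (TensorProduct.assoc K V V V).symm.surjective z
  simp only [three, LinearMap.comp_apply, LinearEquiv.coe_coe, LinearEquiv.apply_symm_apply]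
  induction z using TensorProduct.induction_on with
  | zero => simp
  | add a b ha hb => simp only [map_add, ha, hb]
  | tmul x y =>
    simp only [LinearMap.lTensor_tmul, cons_tmul, act, shift_ι_mul, headBraid_two]

theorem act_braid_zero :
    c.act 0 * c.act 1 * c.act 0 = c.act 1 * c.act 0 * c.act 1 := by
  have h3 (x y z : V) (t : TensorAlgebra K V) : TensorAlgebra.ι K x *
      (TensorAlgebra.ι K y * (TensorAlgebra.ι K z * t)) = three K V t ((x ⊗ₜ y) ⊗ₜ z) := by
    rw [three_tmul, two_tmul]
  have hs (z : V ⊗[K] V) : c.act 1 (two K V 1 z) = 0 := by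
    induction z using TensorProduct.induction_on with
    | zero => simp
    | add a b ha hb => simp only [map_add, ha, hb, add_zero]
    | tmul x y =>
      rw [two_tmul]
      simp only [act, shift_ι_mul, headBraid_ι_mul_one, mul_zero]
  refine end_ext (by simp [act]) fun x t => ?_
  revert x
  induction t using induction_left with
  | h1 => intro x; simp only [Module.End.mul_apply, act, shift_ι_mul, headBraid_ι_mul_one,
      headBraid_one, mul_zero, map_zero]
  | hs r a ha => intro x; simp only [mul_smul_comm, map_smul, ha]
  | hadd a b ha hb => intro x; simp only [mul_add, map_add, ha, hb]
  | hι y t ih =>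
    clear ih
    induction t using induction_left with
    | h1 =>
      intro x
      rw [← two_tmul, Module.End.mul_apply, Module.End.mul_apply, Module.End.mul_apply,
        Module.End.mul_apply, hs, act, headBraid_two, hs, map_zero, map_zero]
    | hs r a ha => intro x; simp only [mul_smul_comm, map_smul, ha]
    | hadd a b ha hb => intro x; simp only [mul_add, map_add, ha, hb]
    | hι z t _ =>
      intro x
      rw [h3]
      simp only [Module.End.mul_apply, act_zero_three, act_one_three]
      exact congrArg (three K V t) (LinearMap.congr_fun c.yang_baxter ((x ⊗ₜ y) ⊗ₜ z))

theorem act_braid (i : ℕ) :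
    c.act i * c.act (i + 1) * c.act i = c.act (i + 1) * c.act i * c.act (i + 1) := by
  induction i with
  | zero => exact c.act_braid_zero
  | succ i ih =>
    have := congrArg (shift K V) ih
    simp only [← shift_mul] at this
    exact this

/-! ### The quantum shuffle algebra -/

variable (K V) in
/-- The homogeneous component `V^{⊗ n}` of the tensor algebra. -/
noncomputable abbrev deg (n : ℕ) : Submodule K (TensorAlgebra K V) :=
  LinearMap.range (TensorAlgebra.ι K : V →ₗ[K] TensorAlgebra K V) ^ n

theorem deg_zero_induction {P : TensorAlgebra K V → Prop} (h : ∀ r : K, P (r • 1))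
    {t : TensorAlgebra K V} (ht : t ∈ deg K V 0) : P t := by
  rw [deg, pow_zero, Submodule.mem_one] at ht
  obtain ⟨r, rfl⟩ := ht
  rw [Algebra.algebraMap_eq_smul_one]
  exact h r

theorem deg_succ_induction {n : ℕ} {P : TensorAlgebra K V → Prop}
    (hadd : ∀ a b, P a → P b → P (a + b))
    (hι : ∀ x, ∀ t ∈ deg K V n, P (TensorAlgebra.ι K x * t))
    {t : TensorAlgebra K V} (ht : t ∈ deg K V (n + 1)) : P t := by
  rw [deg, pow_succ'] at ht
  refine Submodule.mul_induction_on ht ?_ hadd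
  rintro _ ⟨x, rfl⟩ t ht
  exact hι x t ht

theorem ι_mul_mem {n : ℕ} (x : V) {t : TensorAlgebra K V} (ht : t ∈ deg K V n) :
    TensorAlgebra.ι K x * t ∈ deg K V (n + 1) := by
  rw [deg, pow_succ']
  exact Submodule.mul_mem_mul ⟨x, rfl⟩ ht

theorem two_mem {n : ℕ} {t : TensorAlgebra K V} (ht : t ∈ deg K V n) (z : V ⊗[K] V) :
    two K V t z ∈ deg K V (n + 2) := by
  induction z using TensorProduct.induction_on with
  | zero => simp
  | add a b ha hb => rw [map_add]; exact add_mem ha hb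
  | tmul x y => rw [two_tmul]; exact ι_mul_mem x (ι_mul_mem y ht)

theorem act_mem (i : ℕ) {n : ℕ} {u : TensorAlgebra K V} (hu : u ∈ deg K V n) :
    c.act i u ∈ deg K V n := by
  induction i generalizing n u with
  | zero =>
    rcases n with _ | _ | n
    · refine deg_zero_induction (P := fun u => c.act 0 u ∈ _) (fun r => ?_) hu
      simp [act]
    · refine deg_succ_induction (P := fun u => c.act 0 u ∈ _)
        (fun a b ha hb => ?_) (fun x t ht => ?_) hu
      · rw [map_add]; exact add_mem ha hb
      · refine deg_zero_induction (P := fun t => c.act 0 (TensorAlgebra.ι K x * t) ∈ _)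
          (fun r => ?_) ht
        simp only [act, mul_smul_comm, map_smul, headBraid_ι_mul_one, smul_zero, zero_mem]
    · refine deg_succ_induction (P := fun u => c.act 0 u ∈ _)
        (fun a b ha hb => ?_) (fun x t ht => ?_) hu
      · rw [map_add]; exact add_mem ha hb
      · refine deg_succ_induction (P := fun t => c.act 0 (TensorAlgebra.ι K x * t) ∈ _)
          (fun a b ha hb => ?_) (fun y t ht => ?_) ht
        · rw [mul_add, map_add]; exact add_mem ha hb
        · rw [act, headBraid_ι_mul_ι_mul]; exact two_mem ht _
  | succ i ih =>
    rcases n with _ | n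
    · refine deg_zero_induction (P := fun u => c.act (i + 1) u ∈ _) (fun r => ?_) hu
      simp [act]
    · refine deg_succ_induction (P := fun u => c.act (i + 1) u ∈ _)
        (fun a b ha hb => ?_) (fun x t ht => ?_) hu
      · rw [map_add]; exact add_mem ha hb
      · rw [act, shift_ι_mul]; exact ι_mul_mem x (ih ht)

theorem act_mul_right (i : ℕ) {n : ℕ} (hn : i + 2 ≤ n) {u : TensorAlgebra K V}
    (hu : u ∈ deg K V n) (t : TensorAlgebra K V) : c.act i (u * t) = c.act i u * t := by
  induction i generalizing n u with
  | zero =>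
    obtain ⟨n, rfl⟩ : ∃ m, n = m + 2 := ⟨n - 2, by omega⟩
    refine deg_succ_induction (P := fun u => c.act 0 (u * t) = c.act 0 u * t)
      (fun a b ha hb => ?_) (fun x u hu => ?_) hu
    · rw [map_add, add_mul, add_mul, map_add, ha, hb]
    · refine deg_succ_induction (P := fun u => c.act 0 (TensorAlgebra.ι K x * u * t) =
          c.act 0 (TensorAlgebra.ι K x * u) * t) (fun a b ha hb => ?_) (fun y u hu => ?_) hu
      · rw [mul_add, map_add, add_mul, add_mul, map_add, ha, hb]
      · rw [act, mul_assoc, mul_assoc, headBraid_ι_mul_ι_mul, headBraid_ι_mul_ι_mul, two_mul]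
  | succ i ih =>
    obtain ⟨n, rfl⟩ : ∃ m, n = m + 1 := ⟨n - 1, by omega⟩
    refine deg_succ_induction (P := fun u => c.act (i + 1) (u * t) = c.act (i + 1) u * t)
      (fun a b ha hb => ?_) (fun x u hu => ?_) hu
    · rw [map_add, add_mul, add_mul, map_add, ha, hb]
    · rw [act, mul_assoc, shift_ι_mul, shift_ι_mul, ih (by omega) hu, mul_assoc]

theorem act_mul_left (m i : ℕ) {u : TensorAlgebra K V} (hu : u ∈ deg K V m)
    (t : TensorAlgebra K V) : c.act (m + i) (u * t) = u * c.act i t := by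
  induction m generalizing u with
  | zero =>
    refine deg_zero_induction (P := fun u => c.act (0 + i) (u * t) = u * c.act i t)
      (fun r => ?_) hu
    simp
  | succ m ih =>
    refine deg_succ_induction (P := fun u => c.act (m + 1 + i) (u * t) = u * c.act i t)
      (fun a b ha hb => ?_) (fun x u hu => ?_) hu
    · rw [add_mul, add_mul, map_add, ha, hb]
    · rw [show m + 1 + i = m + i + 1 by omega, act, mul_assoc, shift_ι_mul, ih hu, mul_assoc]

theorem shuffle_mem_and (p q : ℕ) {u : TensorAlgebra K V} (hu : u ∈ deg K V (p + q)) :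
    shuffle c.act 0 p q u ∈ deg K V (p + q) ∧
      ∀ t, shuffle c.act 0 p q (u * t) = shuffle c.act 0 p q u * t := by
  have h := shuffle_rel c.act c.act (fun f _ => ∀ u ∈ deg K V (p + q), f u ∈ deg K V (p + q) ∧
    ∀ t, f (u * t) = f u * t) (fun u hu => ⟨hu, fun t => rfl⟩)
    (fun f _ g _ hf hg u hu => ⟨add_mem (hf u hu).1 (hg u hu).1, fun t => by
      rw [LinearMap.add_apply, (hf u hu).2, (hg u hu).2, LinearMap.add_apply, add_mul]⟩)
    (fun f _ g _ hf hg u hu => ⟨(hf _ (hg u hu).1).1, fun t => by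
      rw [Module.End.mul_apply, (hg u hu).2, (hf _ (hg u hu).1).2, Module.End.mul_apply]⟩)
    0 0 p q (fun j _ hj u hu => ⟨c.act_mem _ hu, c.act_mul_right _ (by omega) hu⟩)
  exact h u hu

theorem shuffle_mul_left (m p q : ℕ) {u : TensorAlgebra K V} (hu : u ∈ deg K V m)
    (t : TensorAlgebra K V) :
    shuffle c.act m p q (u * t) = u * shuffle c.act 0 p q t := by
  have h := shuffle_rel c.act c.act (fun f g => ∀ t, f (u * t) = u * g t) (fun t => rfl)
    (fun f g f' g' h h' t => by
      rw [LinearMap.add_apply, h, h', LinearMap.add_apply, mul_add])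
    (fun f g f' g' h h' t => by
      rw [Module.End.mul_apply, h', h, Module.End.mul_apply])
    m 0 p q (fun j _ _ => c.act_mul_left m j hu)
  exact h t

/-- The quantum shuffle product: for `u ∈ V^{⊗ p}` and `v ∈ V^{⊗ q}`, the sum of the lifts of the
`(p, q)`-shuffles is applied to the concatenation of `u` and `v`. -/
noncomputable def shuffleMul :
    TensorAlgebra K V →ₗ[K] TensorAlgebra K V →ₗ[K] TensorAlgebra K V :=
  (DirectSum.toModule K ℕ _ fun p =>
    ((DirectSum.toModule K ℕ _ fun q =>
      ((LinearMap.mul K (TensorAlgebra K V)).compr₂ (shuffle c.act 0 p q)).flip ∘ₗ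
        (deg K V q).subtype) ∘ₗ
      (DirectSum.decomposeLinearEquiv (deg K V)).toLinearMap).flip ∘ₗ (deg K V p).subtype) ∘ₗ
    (DirectSum.decomposeLinearEquiv (deg K V)).toLinearMap

theorem shuffleMul_apply {p q : ℕ} {u v : TensorAlgebra K V} (hu : u ∈ deg K V p)
    (hv : v ∈ deg K V q) : c.shuffleMul u v = shuffle c.act 0 p q (u * v) := by
  simp only [shuffleMul, LinearMap.comp_apply, LinearEquiv.coe_coe,
    DirectSum.decomposeLinearEquiv_apply, DirectSum.decompose_of_mem _ hu]
  rw [← DirectSum.lof_eq_of K, DirectSum.toModule_lof]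
  simp only [LinearMap.comp_apply, LinearMap.flip_apply, LinearEquiv.coe_coe,
    DirectSum.decomposeLinearEquiv_apply, DirectSum.decompose_of_mem _ hv]
  rw [← DirectSum.lof_eq_of K, DirectSum.toModule_lof]
  simp

theorem one_shuffleMul (v : TensorAlgebra K V) : c.shuffleMul 1 v = v := by
  induction v using DirectSum.Decomposition.inductionOn (deg K V) with
  | zero => simp
  | add a b ha hb => rw [map_add, ha, hb]
  | homogeneous v =>
    rw [shuffleMul_apply c (p := 0) (by rw [deg, pow_zero]; exact Submodule.one_le.mp le_rfl) v.2,
      shuffle_zero_left, one_mul, Module.End.one_apply]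

theorem shuffleMul_one (v : TensorAlgebra K V) : c.shuffleMul v 1 = v := by
  induction v using DirectSum.Decomposition.inductionOn (deg K V) with
  | zero => simp
  | add a b ha hb => rw [map_add, LinearMap.add_apply, ha, hb]
  | homogeneous v =>
    rw [shuffleMul_apply c (q := 0) v.2 (by rw [deg, pow_zero]; exact Submodule.one_le.mp le_rfl),
      shuffle_zero_right, mul_one, Module.End.one_apply]

theorem shuffleMul_assoc (u v w : TensorAlgebra K V) :
    c.shuffleMul (c.shuffleMul u v) w = c.shuffleMul u (c.shuffleMul v w) := by
  induction u using DirectSum.Decomposition.inductionOn (deg K V) with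
  | zero => simp
  | add a b ha hb => simp only [map_add, LinearMap.add_apply, ha, hb]
  | @homogeneous p u =>
  induction v using DirectSum.Decomposition.inductionOn (deg K V) with
  | zero => simp
  | add a b ha hb => simp only [map_add, LinearMap.add_apply, ha, hb]
  | @homogeneous q v =>
  induction w using DirectSum.Decomposition.inductionOn (deg K V) with
  | zero => simp
  | add a b ha hb => simp only [map_add, ha, hb]
  | @homogeneous r w =>
  have huv : (u * v : TensorAlgebra K V) ∈ deg K V (p + q) := by
    rw [deg, pow_add]; exact Submodule.mul_mem_mul u.2 v.2
  have hvw : (v * w : TensorAlgebra K V) ∈ deg K V (q + r) := by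
    rw [deg, pow_add]; exact Submodule.mul_mem_mul v.2 w.2
  rw [c.shuffleMul_apply u.2 v.2, c.shuffleMul_apply v.2 w.2,
    c.shuffleMul_apply (c.shuffle_mem_and p q huv).1 w.2,
    c.shuffleMul_apply u.2 (c.shuffle_mem_and q r hvw).1,
    ← (c.shuffle_mem_and p q huv).2, ← c.shuffle_mul_left p q r u.2, mul_assoc,
    ← Module.End.mul_apply, ← Module.End.mul_apply,
    shuffle_assoc c.act_braid c.act_far 0 p q r, zero_add]

/-- The quantum shuffle algebra `T^c(V, c)`: the vector space underlying the tensor algebra with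
the quantum shuffle product. -/
def QuantumShuffleAlgebra (_c : Braiding K V) : Type (max u v) := TensorAlgebra K V

namespace QuantumShuffleAlgebra

noncomputable instance : AddCommGroup c.QuantumShuffleAlgebra :=
  inferInstanceAs (AddCommGroup (TensorAlgebra K V))

noncomputable instance : Module K c.QuantumShuffleAlgebra :=
  inferInstanceAs (Module K (TensorAlgebra K V))

/-- The identity map from the tensor algebra to the quantum shuffle algebra. -/
noncomputable def ofTensor : TensorAlgebra K V ≃ₗ[K] c.QuantumShuffleAlgebra :=
  LinearEquiv.refl K (TensorAlgebra K V)

noncomputable instance : Ring c.QuantumShuffleAlgebra where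
  __ := (inferInstance : AddCommGroup c.QuantumShuffleAlgebra)
  one := ofTensor c 1
  mul a b := ofTensor c (c.shuffleMul ((ofTensor c).symm a) ((ofTensor c).symm b))
  one_mul := c.one_shuffleMul
  mul_one := c.shuffleMul_one
  mul_assoc := c.shuffleMul_assoc
  left_distrib a b d := map_add (c.shuffleMul a) b d
  right_distrib a b d := LinearMap.map_add₂ c.shuffleMul a b d
  zero_mul a := LinearMap.map_zero₂ c.shuffleMul a
  mul_zero a := map_zero (c.shuffleMul a)

noncomputable instance : Algebra K c.QuantumShuffleAlgebra :=
  Algebra.ofModule (fun r a b => LinearMap.map_smul₂ c.shuffleMul r a b)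
    (fun r a b => map_smul (c.shuffleMul a) r b)

end QuantumShuffleAlgebra

/-- The algebra homomorphism `Γ : T(V) → T^c(V, c)` that is the identity on `V`. -/
noncomputable def Γ : TensorAlgebra K V →ₐ[K] c.QuantumShuffleAlgebra :=
  TensorAlgebra.lift K
    ((QuantumShuffleAlgebra.ofTensor c).toLinearMap ∘ₗ TensorAlgebra.ι K)

/-- The Nichols algebra of `(V, c)`: the image of `Γ`. -/
noncomputable abbrev NicholsAlgebra : Subalgebra K c.QuantumShuffleAlgebra := c.Γ.range

/-- `E₂(V, c)`, the kernel of `c + Id` on `V ⊗ V`. -/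
noncomputable def E₂ : Submodule K (V ⊗[K] V) := LinearMap.ker (c.toLin + LinearMap.id)

variable (K V) in
/-- The inclusion `x ⊗ y ↦ x y` of `V ⊗ V` into the tensor algebra. -/
noncomputable def ι₂ : V ⊗[K] V →ₗ[K] TensorAlgebra K V :=
  LinearMap.mul' K (TensorAlgebra K V) ∘ₗ
    TensorProduct.map (TensorAlgebra.ι K) (TensorAlgebra.ι K)

/-- The two-sided ideal of `T(V)` generated by `E₂(V, c)`. -/
noncomputable def quadraticIdeal : TwoSidedIdeal (TensorAlgebra K V) :=
  TwoSidedIdeal.span (ι₂ K V '' (c.E₂ : Set (V ⊗[K] V)))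

/-- The quadratic symmetric algebra `S_Q(V, c) = T(V) / (E₂(V, c))`. -/
abbrev QuadraticSymmetricAlgebra : Type (max u v) := c.quadraticIdeal.ringCon.Quotient

/-- `S_Q(V, c) = B(V, c)`: the two quotients of `T(V)` are the same, that is, there is an
isomorphism of algebras between them that is compatible with the canonical surjections
`T(V) → S_Q(V, c)` and `Γ : T(V) → B(V, c)`. -/
def SymmetricEqNichols : Prop :=
  ∃ e : c.QuadraticSymmetricAlgebra ≃ₐ[K] c.NicholsAlgebra,
    ∀ t : TensorAlgebra K V, e (c.quadraticIdeal.ringCon.mk' t) = c.Γ.rangeRestrict t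

end Braiding

/-! ### The table of two-dimensional braided vector spaces -/

/-- The eight cases of the table. -/
inductive TableCase
  | case1 | case2 | case3 | case4 | case5 | case6 | case7 | case8

namespace TableCase

variable {K : Type u} [Field K]

/-- The matrix of the braiding, with respect to the ordered basis
`x₁ ⊗ x₁, x₂ ⊗ x₁, x₁ ⊗ x₂, x₂ ⊗ x₂`; its columns are the coordinates of the images. -/
def matrix (γ : K) : TableCase → Matrix (Fin 4) (Fin 4) K
  | case1 => !![1, 0, 0, 0; 0, 0, 1, 0; 0, 1, 0, 0; 0, 0, 0, 1]
  | case2 => !![1, 1, -1, 0; 0, 0, 1, 0; 0, 1, 0, 0; 0, 0, 0, 1]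
  | case3 => !![-1, 0, 0, γ; 0, 0, 1, 0; 0, 1, 0, 0; 0, 0, 0, 1]
  | case4 => !![1, 0, 0, γ; 0, 0, 1, 0; 0, 1, 0, 0; 0, 0, 0, -1]
  | case5 => !![0, 1, 0, 0; 0, 0, 1, 0; 0, 1, 0, 0; 0, 0, 0, 1]
  | case6 => !![0, 0, 0, 0; 0, 0, γ, 0; 0, γ⁻¹, 0, 0; 0, 0, 0, 1]
  | case7 => !![γ, 0, 0, 0; 0, 0, 1, 0; 0, 1, 0, 0; 0, 0, 0, 1]
  | case8 => !![1, 0, 0, γ; 0, 0, 1, 0; 0, 1, 0, 0; 0, 0, 0, 1]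

/-- The restrictions on the parameter `γ`. -/
def Admissible (γ : K) : TableCase → Prop
  | case1 => True
  | case2 => True
  | case3 => γ = 0 ∨ γ = 1 ∨ ¬ IsSquare γ
  | case4 => γ = 0 ∨ γ = 1 ∨ ¬ IsSquare γ
  | case5 => True
  | case6 => γ ≠ 0 ∧ γ ≠ 1
  | case7 => γ ≠ 1 ∧ γ ≠ -1
  | case8 => γ = 1 ∨ ¬ IsSquare γ

variable {V : Type v} [AddCommGroup V] [Module K V]

/-- The family `x₁ ⊗ x₁, x₂ ⊗ x₁, x₁ ⊗ x₂, x₂ ⊗ x₂`, where `x₁ = x 0` and `x₂ = x 1`. -/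
def tensors (x : Fin 2 → V) : Fin 4 → V ⊗[K] V :=
  ![x 0 ⊗ₜ x 0, x 1 ⊗ₜ x 0, x 0 ⊗ₜ x 1, x 1 ⊗ₜ x 1]

/-- The braided vector space `(V, c)` is as in case `i` of the table with parameter `γ`. -/
def IsOfCase (c : Braiding K V) (i : TableCase) (γ : K) : Prop :=
  i.Admissible γ ∧ ∃ x : Module.Basis (Fin 2) K V,
    ∀ j, c.toLin (tensors x j) = ∑ k, i.matrix γ k j • tensors (K := K) x k

end TableCase

/-! Write x₁ = `x 0`, x₂ = `x 1`, and let ∂₁, ∂₂ be the contractions of the first letter with the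
coordinate forms (`strip`). Against left shuffle multiplication by a letter (`letterMul`) they
satisfy twisted Leibniz rules. All eight matrices have one common shape, `HasShape`, in which q and
p are the corner entries and r is the coefficient of x₂ ⊗ x₁ in c(x₁ ⊗ x₂). With [k]_t = 1 + t + ⋯ +
t^(k-1), the rules show that ∂₂ⁿ, followed by ∂₁ᵐ and the constant term, sends Γ(x₁ᵐ x₂ⁿ) to r^(mn)
[n]_p! [m]_q!, and that the system of these forms is triangular. Hence ordered monomials with
nonzero quantum factorials stay independent in the Nichols algebra (`linearIndependent_monomials`).

Sufficiency: E₂ always contains a relation x₂x₁ - κ x₁x₂ - l x₁², so ordered monomials span S_Q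
(`top_le_span_monomials`). If q = -1 or p = -1 in the table, a further relation, x₁² or x₂² - μ x₁²,
leaves only exponents of that letter below 2, where the factorials do not vanish. A spanning family
with independent images makes the canonical surjection from S_Q to the Nichols algebra injective.

Necessity: in positive characteristic, or for γ a root of unity in case 7, a quantum integer
vanishes and Γ kills a power of x₁ or of x₂. That power is not in the ideal (E₂), because some
algebra homomorphism on T(V) kills E₂ and sends the power to 1. -/

namespace Braiding

/-! ### Left shuffle multiplication by letters, and the canonical map from S_Q to the Nichols
algebra -/

open TensorProduct BraidShuffle

variable {K : Type u} {V : Type v} [Field K] [AddCommGroup V] [Module K V] (c : Braiding K V)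

/-- Left multiplication by a letter in the quantum shuffle algebra. -/
noncomputable def letterMul : V →ₗ[K] Module.End K (TensorAlgebra K V) :=
  c.shuffleMul ∘ₗ TensorAlgebra.ι K

theorem letterMul_one (x : V) : c.letterMul x 1 = TensorAlgebra.ι K x :=
  c.shuffleMul_one _

theorem ι_mem_deg_one (x : V) : TensorAlgebra.ι K x ∈ deg K V 1 := by
  rw [deg, pow_one]; exact ⟨x, rfl⟩

/-- `y ⊗ x ↦ y (x ⧢ t)`. -/
noncomputable def secondMul (t : TensorAlgebra K V) : V ⊗[K] V →ₗ[K] TensorAlgebra K V :=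
  cons K V ∘ₗ (c.letterMul.flip t).lTensor V

theorem secondMul_tmul (t : TensorAlgebra K V) (y x : V) :
    c.secondMul t (y ⊗ₜ x) = TensorAlgebra.ι K y * c.letterMul x t := by
  simp [secondMul, cons_tmul]

theorem secondMul_add (s t : TensorAlgebra K V) (z : V ⊗[K] V) :
    c.secondMul (s + t) z = c.secondMul s z + c.secondMul t z := by
  simp [secondMul, LinearMap.lTensor_add]

/-- Either x stays in front, or y is first moved past x by the braiding and the letter now in second
place is shuffled into t. This is the recursion of `shuffle` for a one-letter left factor. -/
theorem letterMul_ι_mul (x y : V) (t : TensorAlgebra K V) :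
    c.letterMul x (TensorAlgebra.ι K y * t) =
      TensorAlgebra.ι K x * (TensorAlgebra.ι K y * t) + c.secondMul t (c.toLin (x ⊗ₜ y)) := by
  induction t using DirectSum.Decomposition.inductionOn (deg K V) with
  | zero => simp [secondMul]
  | add a b ha hb => rw [mul_add, map_add, ha, hb, mul_add, secondMul_add]; abel
  | @homogeneous n t =>
    have h (x : V) : c.letterMul x (t : TensorAlgebra K V) =
        shuffle c.act 0 1 n (TensorAlgebra.ι K x * t) :=
      c.shuffleMul_apply (ι_mem_deg_one x) t.2
    have h2 (z : V ⊗[K] V) : shuffle c.act 1 1 n (two K V t z) = c.secondMul t z := by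
      induction z using TensorProduct.induction_on with
      | zero => simp
      | add a b ha hb => simp only [map_add, ha, hb]
      | tmul y x =>
        rw [two_tmul, c.shuffle_mul_left 1 1 n (ι_mem_deg_one y), secondMul_tmul, h]
    rw [letterMul, LinearMap.comp_apply,
      c.shuffleMul_apply (ι_mem_deg_one x) (ι_mul_mem y t.2), shuffle_succ, shuffle_zero_left,
      chain, chain, mul_one, LinearMap.add_apply, Module.End.one_apply, Module.End.mul_apply, act,
      headBraid_ι_mul_ι_mul, zero_add, h2]

/-- By associativity, composing the two operators is multiplication by a shuffle product of degree
two, so only that product has to be compared. -/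
theorem letterMul_comm_of_one {x y : V}
    (h : c.letterMul x (TensorAlgebra.ι K y) = c.letterMul y (TensorAlgebra.ι K x)) :
    Commute (c.letterMul x) (c.letterMul y) := by
  ext1 t
  change c.shuffleMul _ (c.shuffleMul _ t) = c.shuffleMul _ (c.shuffleMul _ t)
  rw [← shuffleMul_assoc, ← shuffleMul_assoc]
  exact congrArg (fun s => c.shuffleMul s t) h

theorem Γ_ι_mul (x : V) (t : TensorAlgebra K V) :
    (QuantumShuffleAlgebra.ofTensor c).symm (c.Γ (TensorAlgebra.ι K x * t)) =
      c.letterMul x ((QuantumShuffleAlgebra.ofTensor c).symm (c.Γ t)) := by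
  rw [map_mul]
  have h : c.Γ (TensorAlgebra.ι K x) = QuantumShuffleAlgebra.ofTensor c (TensorAlgebra.ι K x) := by
    simp [Γ]
  rw [h]
  rfl

theorem Γ_one : (QuantumShuffleAlgebra.ofTensor c).symm (c.Γ 1) = 1 := by
  rw [map_one]; rfl

theorem Γ_pow_mul (x : V) (n : ℕ) (t : TensorAlgebra K V) :
    (QuantumShuffleAlgebra.ofTensor c).symm (c.Γ (TensorAlgebra.ι K x ^ n * t)) =
      (c.letterMul x ^ n) ((QuantumShuffleAlgebra.ofTensor c).symm (c.Γ t)) := by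
  induction n with
  | zero => simp
  | succ n ih => rw [pow_succ', mul_assoc, Γ_ι_mul, ih, pow_succ', Module.End.mul_apply]

theorem Γ_pow (x : V) (n : ℕ) :
    (QuantumShuffleAlgebra.ofTensor c).symm (c.Γ (TensorAlgebra.ι K x ^ n)) =
      (c.letterMul x ^ n) 1 := by
  rw [← mul_one (TensorAlgebra.ι K x ^ n), Γ_pow_mul, Γ_one]

/-- In degree two Γ is the braided symmetrizer c + Id, so the elements of `E₂` are relations of the
Nichols algebra. -/
theorem Γ_ι₂ (z : V ⊗[K] V) :
    (QuantumShuffleAlgebra.ofTensor c).symm (c.Γ (ι₂ K V z)) =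
      ι₂ K V (c.toLin z + z) := by
  have h (z : V ⊗[K] V) : c.secondMul 1 z = ι₂ K V z := by
    induction z using TensorProduct.induction_on with
    | zero => simp
    | add a b ha hb => simp only [map_add, ha, hb]
    | tmul x y => rw [secondMul_tmul, letterMul_one]; simp [ι₂]
  induction z using TensorProduct.induction_on with
  | zero => simp
  | add a b ha hb => simp only [map_add] at ha hb ⊢; rw [ha, hb]; abel
  | tmul x y =>
    have : ι₂ K V (x ⊗ₜ y) = TensorAlgebra.ι K x * (TensorAlgebra.ι K y * 1) := by simp [ι₂]
    rw [map_add, this, Γ_ι_mul, Γ_ι_mul, Γ_one,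
      letterMul_one, ← h, ← mul_one (TensorAlgebra.ι K y), letterMul_ι_mul, add_comm]
    simp only [mul_one]

/-- There is a canonical homomorphism from `S_Q(V, c)` to the Nichols algebra. -/
theorem exists_quadratic_lift :
    ∃ f : c.QuadraticSymmetricAlgebra →ₐ[K] c.NicholsAlgebra,
      ∀ t : TensorAlgebra K V, f (c.quadraticIdeal.ringCon.mk' t) = c.Γ.rangeRestrict t := by
  have h : ∀ t, t ∈ c.quadraticIdeal → c.Γ t = 0 := by
    intro t ht
    have : c.quadraticIdeal ≤ TwoSidedIdeal.ker c.Γ := by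
      refine TwoSidedIdeal.span_le.2 ?_
      rintro _ ⟨z, hz, rfl⟩
      rw [SetLike.mem_coe, TwoSidedIdeal.mem_ker]
      apply (QuantumShuffleAlgebra.ofTensor c).symm.injective
      rw [Γ_ι₂, show c.toLin z + z = 0 from hz, map_zero, map_zero]
    exact (TwoSidedIdeal.mem_ker _).1 (this ht)
  have h2 : ∀ s t, c.quadraticIdeal.ringCon s t → c.Γ.rangeRestrict s = c.Γ.rangeRestrict t := by
    intro s t hst
    apply Subtype.ext
    have := h _ (c.quadraticIdeal.rel_iff s t |>.1 hst)
    rw [map_sub, sub_eq_zero] at this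
    exact this
  exact ⟨c.quadraticIdeal.ringCon.liftₐ c.Γ.rangeRestrict fun s t hst => h2 s t hst,
    fun t => rfl⟩

theorem mk'_eq_zero_of_mem {z : V ⊗[K] V} (hz : z ∈ c.E₂) :
    c.quadraticIdeal.ringCon.mk' (ι₂ K V z) = 0 := by
  have : ι₂ K V z ∈ c.quadraticIdeal := TwoSidedIdeal.subset_span ⟨z, hz, rfl⟩
  rw [← map_zero c.quadraticIdeal.ringCon.mk']
  exact (RingCon.eq _).2 ((c.quadraticIdeal.mem_iff _).1 this)

/-- A homomorphism that vanishes on `E₂` vanishes on `ker Γ` if `S_Q(V, c) = B(V, c)`. -/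
theorem SymmetricEqNichols.map_eq_zero {c : Braiding K V} (h : c.SymmetricEqNichols)
    {S : Type*} [Ring S] [Algebra K S] (f : TensorAlgebra K V →ₐ[K] S)
    (hf : ∀ z ∈ c.E₂, f (ι₂ K V z) = 0) {t : TensorAlgebra K V} (ht : c.Γ t = 0) : f t = 0 := by
  obtain ⟨e, he⟩ := h
  have h1 : c.quadraticIdeal.ringCon.mk' t = c.quadraticIdeal.ringCon.mk' 0 := by
    apply e.injective
    rw [he, he]
    apply Subtype.ext
    simpa using ht
  have h2 : t ∈ c.quadraticIdeal := (c.quadraticIdeal.mem_iff _).2 ((RingCon.eq _).1 h1)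
  have h3 : c.quadraticIdeal ≤ TwoSidedIdeal.ker f := by
    refine TwoSidedIdeal.span_le.2 ?_
    rintro _ ⟨z, hz, rfl⟩
    exact (TwoSidedIdeal.mem_ker _).2 (hf z hz)
  exact (TwoSidedIdeal.mem_ker _).1 (h3 h2)

/-- The canonical map is onto because Γ is onto its range; only injectivity is at stake, and it can
be tested on a spanning family. -/
theorem symmetricEqNichols_of_linearIndependent {ι : Type*} (v : ι → TensorAlgebra K V)
    (hspan : ⊤ ≤ Submodule.span K (Set.range fun i => c.quadraticIdeal.ringCon.mk' (v i)))
    (hv : LinearIndependent K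
      fun i => (QuantumShuffleAlgebra.ofTensor c).symm (c.Γ (v i))) :
    c.SymmetricEqNichols := by
  obtain ⟨f, hf⟩ := c.exists_quadratic_lift
  have hinj : Function.Injective f := by
    rw [injective_iff_map_eq_zero]
    intro y hy
    obtain ⟨l, rfl⟩ := Finsupp.mem_span_range_iff_exists_finsupp.1
      (hspan (Submodule.mem_top (x := y)))
    have : l = 0 := by
      apply linearIndependent_iff.1 hv l
      rw [Finsupp.linearCombination_apply]
      have h2 := congrArg (fun s => (QuantumShuffleAlgebra.ofTensor c).symm
        (Subalgebra.val _ s)) hy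
      simp only [Finsupp.sum, map_sum, map_smul, hf, map_zero] at h2 ⊢
      exact h2
    simp [this]
  refine ⟨AlgEquiv.ofBijective f ⟨hinj, fun y => ?_⟩, hf⟩
  obtain ⟨t, rfl⟩ := c.Γ.rangeRestrict_surjective y
  exact ⟨_, hf t⟩

end Braiding

/-! ### Contractions and their twisted Leibniz rules -/

namespace Braiding

open TensorProduct BraidShuffle

variable {K : Type u} {V : Type v} [Field K] [AddCommGroup V] [Module K V]

section Strip

/-- Contraction of the first letter with a linear form: `x t ↦ f(x) t` and `1 ↦ 0`. -/
noncomputable def strip (f : V →ₗ[K] K) : Module.End K (TensorAlgebra K V) :=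
  (TensorProduct.lid K (TensorAlgebra K V)).toLinearMap ∘ₗ
    f.rTensor (TensorAlgebra K V) ∘ₗ uncons K V

@[simp] theorem strip_one (f : V →ₗ[K] K) : strip f 1 = 0 := by simp [strip]

@[simp] theorem strip_ι_mul (f : V →ₗ[K] K) (x : V) (t : TensorAlgebra K V) :
    strip f (TensorAlgebra.ι K x * t) = f x • t := by simp [strip]

@[simp] theorem strip_ι (f : V →ₗ[K] K) (x : V) :
    strip f (TensorAlgebra.ι K x) = f x • 1 := by
  rw [← mul_one (TensorAlgebra.ι K x), strip_ι_mul]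

theorem algebraMapInv_ι_mul (x : V) (t : TensorAlgebra K V) :
    TensorAlgebra.algebraMapInv (TensorAlgebra.ι K x * t) = 0 := by
  simp [TensorAlgebra.algebraMapInv]

/-- An element is determined by its constant term and its contractions. -/
theorem eq_zero_of_strip (x : Module.Basis (Fin 2) K V) {t : TensorAlgebra K V}
    (h : TensorAlgebra.algebraMapInv t = 0) (h0 : strip (x.coord 0) t = 0)
    (h1 : strip (x.coord 1) t = 0) : t = 0 := by
  -- Every tensor is its constant term plus its expansion x₁ ∂₁t + x₂ ∂₂t along the first letter.
  have key : t = algebraMap K _ (TensorAlgebra.algebraMapInv t) +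
      TensorAlgebra.ι K (x 0) * strip (x.coord 0) t +
      TensorAlgebra.ι K (x 1) * strip (x.coord 1) t := by
    clear h h0 h1
    induction t using induction_left with
    | h1 => simp
    | hs r a ha =>
      conv_lhs => rw [ha]
      simp only [map_smul, smul_eq_mul, map_mul, mul_smul_comm, smul_add,
        Algebra.smul_def r (algebraMap _ _ _)]
    | hadd a b ha hb =>
      conv_lhs => rw [ha, hb]
      simp only [map_add, mul_add]
      abel
    | hι y t _ =>
      rw [algebraMapInv_ι_mul, map_zero, zero_add, strip_ι_mul,
        strip_ι_mul, mul_smul_comm, mul_smul_comm]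
      conv_lhs => rw [← x.sum_repr y]
      simp only [Fin.sum_univ_two, map_add, map_smul, add_mul, smul_mul_assoc,
        Module.Basis.coord_apply]
  rw [key, h, h0, h1]
  simp

end Strip

/-- The braiding is upper triangular in the sense of the table: all matrices of the table have
this form with respect to the basis `x`. -/
structure HasShape (c : Braiding K V) (x : Module.Basis (Fin 2) K V) (q u w g r s p : K) :
    Prop where
  aa : c.toLin (x 0 ⊗ₜ x 0) = q • (x 0 ⊗ₜ x 0)
  ba : c.toLin (x 1 ⊗ₜ x 0) = u • (x 0 ⊗ₜ x 0) + s • (x 0 ⊗ₜ x 1)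
  ab : c.toLin (x 0 ⊗ₜ x 1) = w • (x 0 ⊗ₜ x 0) + r • (x 1 ⊗ₜ x 0)
  bb : c.toLin (x 1 ⊗ₜ x 1) = g • (x 0 ⊗ₜ x 0) + p • (x 1 ⊗ₜ x 1)

theorem end_ext_basis (x : Module.Basis (Fin 2) K V) {f g : Module.End K (TensorAlgebra K V)}
    (h1 : f 1 = g 1) (h : ∀ i t, f (TensorAlgebra.ι K (x i) * t) =
      g (TensorAlgebra.ι K (x i) * t)) : f = g := by
  refine end_ext h1 fun y t => ?_
  rw [← x.sum_repr y]
  simp only [map_sum, Finset.sum_mul, map_smul, smul_mul_assoc, h]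

namespace HasShape

variable {c : Braiding K V} {x : Module.Basis (Fin 2) K V} {q u w g r s p : K}

/-- First of four twisted Leibniz rules, for ∂₁ and ∂₂ against x₁ and x₂. Each is read off from
`letterMul_ι_mul`: the unit comes from x staying in front, the other terms from the entries of c. -/
theorem strip_zero_letterMul_zero (h : HasShape c x q u w g r s p) :
    strip (x.coord 0) * c.letterMul (x 0) =
    1 + q • (c.letterMul (x 0) * strip (x.coord 0)) +
      w • (c.letterMul (x 0) * strip (x.coord 1)) := by
  refine end_ext_basis x (by simp [letterMul_one]) fun i t => ?_
  fin_cases i <;> simp [letterMul_ι_mul, h.aa, h.ab, secondMul_tmul]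

theorem strip_one_letterMul_zero (h : HasShape c x q u w g r s p) :
    strip (x.coord 1) * c.letterMul (x 0) =
    r • (c.letterMul (x 0) * strip (x.coord 1)) := by
  refine end_ext_basis x (by simp [letterMul_one]) fun i t => ?_
  fin_cases i <;> simp [letterMul_ι_mul, h.aa, h.ab, secondMul_tmul]

theorem strip_zero_letterMul_one (h : HasShape c x q u w g r s p) :
    strip (x.coord 0) * c.letterMul (x 1) =
    u • (c.letterMul (x 0) * strip (x.coord 0)) + s • (c.letterMul (x 1) * strip (x.coord 0)) +
      g • (c.letterMul (x 0) * strip (x.coord 1)) := by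
  refine end_ext_basis x (by simp [letterMul_one]) fun i t => ?_
  fin_cases i <;> simp [letterMul_ι_mul, h.ba, h.bb, secondMul_tmul]

theorem strip_one_letterMul_one (h : HasShape c x q u w g r s p) :
    strip (x.coord 1) * c.letterMul (x 1) =
    1 + p • (c.letterMul (x 1) * strip (x.coord 1)) := by
  refine end_ext_basis x (by simp [letterMul_one]) fun i t => ?_
  fin_cases i <;> simp [letterMul_ι_mul, h.ba, h.bb, secondMul_tmul]

end HasShape
end Braiding

/-! ### Independence of ordered monomials in the Nichols algebra -/

namespace Braiding

open TensorProduct BraidShuffle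

variable {K : Type u} {V : Type v} [Field K] [AddCommGroup V] [Module K V]

/-- Vectors indexed by pairs are independent if there are linear forms that are triangular on
them with respect to the second index. -/
theorem linearIndependent_of_triangular {M : Type*} [AddCommGroup M] [Module K M]
    (S : Set (ℕ × ℕ)) (v : ℕ × ℕ → M) (φ : ℕ × ℕ → M →ₗ[K] K)
    (h0 : ∀ i j m n, n < j → φ (i, j) (v (m, n)) = 0)
    (h1 : ∀ i j m, m ≠ i → φ (i, j) (v (m, j)) = 0) (h2 : ∀ a ∈ S, φ a (v a) ≠ 0) :
    LinearIndependent K fun a : S => v a := by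
  rw [linearIndependent_iff]
  intro l hl
  by_contra hne
  -- For a in the support with largest second index, `φ a` kills all other terms of the relation:
  -- smaller second index by `h0`, equal second index by `h1`.
  obtain ⟨a, ha, hmax⟩ := Finset.exists_max_image l.support (fun a => (a : ℕ × ℕ).2)
    (Finsupp.support_nonempty_iff.2 hne)
  have h := congrArg (φ a) hl
  rw [Finsupp.linearCombination_apply, Finsupp.sum, map_sum, map_zero,
    Finset.sum_eq_single a] at h
  · rw [map_smul, smul_eq_mul] at h
    exact (mul_ne_zero (Finsupp.mem_support_iff.1 ha) (h2 a a.2)) h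
  · rintro ⟨⟨m, n⟩, hb⟩ hbl hba
    obtain ⟨⟨i, j⟩, hij⟩ := a
    have hle : n ≤ j := hmax _ hbl
    rw [map_smul]
    rcases hle.lt_or_eq with hlt | rfl
    · rw [h0 _ _ _ _ hlt, smul_zero]
    · rw [h1, smul_zero]
      rintro rfl
      exact hba rfl
  · exact fun hn => absurd ha hn

theorem algebraMapInv_letterMul (c : Braiding K V) (x : V) (t : TensorAlgebra K V) :
    TensorAlgebra.algebraMapInv (c.letterMul x t) = 0 := by
  have h (s : TensorAlgebra K V) (z : V ⊗[K] V) :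
      TensorAlgebra.algebraMapInv (c.secondMul s z) = 0 := by
    induction z using TensorProduct.induction_on with
    | zero => simp
    | add a b ha hb => rw [map_add, map_add, ha, hb, add_zero]
    | tmul y x => rw [secondMul_tmul, algebraMapInv_ι_mul]
  induction t using induction_left with
  | h1 => rw [letterMul_one, ← mul_one (TensorAlgebra.ι K x), algebraMapInv_ι_mul]
  | hs r a ha => rw [map_smul, map_smul, ha, smul_zero]
  | hadd a b ha hb => rw [map_add, map_add, ha, hb, add_zero]
  | hι y t _ => rw [letterMul_ι_mul, map_add, algebraMapInv_ι_mul, h, add_zero]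

namespace HasShape

variable {c : Braiding K V} {x : Module.Basis (Fin 2) K V} {q u w g r s p : K}

theorem strip_one_pow_zero (h : HasShape c x q u w g r s p) (m : ℕ) (t : TensorAlgebra K V) :
    strip (x.coord 1) ((c.letterMul (x 0) ^ m) t) =
      r ^ m • (c.letterMul (x 0) ^ m) (strip (x.coord 1) t) := by
  induction m with
  | zero => simp
  | succ m ih =>
    have := LinearMap.congr_fun h.strip_one_letterMul_zero ((c.letterMul (x 0) ^ m) t)
    simp only [Module.End.mul_apply, LinearMap.smul_apply] at this
    rw [pow_succ', Module.End.mul_apply, this, ih, map_smul, smul_smul, Module.End.mul_apply,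
      pow_succ']

theorem strip_one_pow_zero_one (h : HasShape c x q u w g r s p) (m : ℕ) :
    strip (x.coord 1) ((c.letterMul (x 0) ^ m) 1) = 0 := by
  rw [h.strip_one_pow_zero, strip_one, map_zero, smul_zero]

/-- ∂₂ kills the shuffle powers of x₁, so the w-term of the Leibniz rule drops out and the
coefficients obey [m+1]_q = 1 + q [m]_q. -/
theorem strip_zero_pow_zero_one (h : HasShape c x q u w g r s p) (m : ℕ) :
    strip (x.coord 0) ((c.letterMul (x 0) ^ (m + 1)) 1) =
      (∑ k ∈ Finset.range (m + 1), q ^ k) • (c.letterMul (x 0) ^ m) 1 := by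
  have key (m : ℕ) := LinearMap.congr_fun h.strip_zero_letterMul_zero
    ((c.letterMul (x 0) ^ m) 1)
  simp only [Module.End.mul_apply, LinearMap.smul_apply, LinearMap.add_apply,
    Module.End.one_apply, h.strip_one_pow_zero_one, map_zero, smul_zero, add_zero] at key
  induction m with
  | zero => simpa using key 0
  | succ m ih =>
    rw [pow_succ', Module.End.mul_apply, key, ih, map_smul, smul_smul, ← Module.End.mul_apply,
      ← pow_succ', geom_sum_succ (n := m + 1), add_smul, one_smul, add_comm]

theorem strip_one_pow_one_one (h : HasShape c x q u w g r s p) (n : ℕ) :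
    strip (x.coord 1) ((c.letterMul (x 1) ^ (n + 1)) 1) =
      (∑ k ∈ Finset.range (n + 1), p ^ k) • (c.letterMul (x 1) ^ n) 1 := by
  have key (n : ℕ) := LinearMap.congr_fun h.strip_one_letterMul_one
    ((c.letterMul (x 1) ^ n) 1)
  simp only [Module.End.mul_apply, LinearMap.smul_apply, LinearMap.add_apply,
    Module.End.one_apply] at key
  induction n with
  | zero => simpa using key 0
  | succ n ih =>
    rw [pow_succ', Module.End.mul_apply, key, ih, map_smul, smul_smul, ← Module.End.mul_apply,
      ← pow_succ', geom_sum_succ (n := n + 1), add_smul, one_smul, add_comm]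

/-- Each ∂₂ crosses x₁ᵐ at the cost of a scalar and lowers the exponent of x₂ by one, so more than n
of them give zero. -/
theorem pow_strip_one_of_lt (h : HasShape c x q u w g r s p) (m : ℕ) {n j : ℕ} (hn : n < j) :
    (strip (x.coord 1) ^ j)
      ((c.letterMul (x 0) ^ m) ((c.letterMul (x 1) ^ n) 1)) = 0 := by
  obtain ⟨j, rfl⟩ : ∃ k, j = k + 1 := ⟨j - 1, by omega⟩
  rw [pow_succ, Module.End.mul_apply, h.strip_one_pow_zero]
  induction n generalizing j with
  | zero => simp
  | succ n ih =>
    obtain ⟨j, rfl⟩ : ∃ k, j = k + 1 := ⟨j - 1, by omega⟩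
    rw [h.strip_one_pow_one_one, map_smul, map_smul, map_smul, pow_succ, Module.End.mul_apply,
      h.strip_one_pow_zero, ih _ (by omega), smul_zero, smul_zero]

/-- Each of the n contractions contributes rᵐ from crossing x₁ᵐ and one quantum integer in p. -/
theorem pow_strip_one_self (h : HasShape c x q u w g r s p) (m n : ℕ) :
    (strip (x.coord 1) ^ n)
      ((c.letterMul (x 0) ^ m) ((c.letterMul (x 1) ^ n) 1)) =
      ((r ^ m) ^ n * ∏ j ∈ Finset.range n, ∑ k ∈ Finset.range (j + 1), p ^ k) •
        (c.letterMul (x 0) ^ m) 1 := by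
  induction n with
  | zero => simp
  | succ n ih =>
    rw [pow_succ, Module.End.mul_apply, h.strip_one_pow_zero, h.strip_one_pow_one_one]
    simp only [map_smul]
    rw [ih, smul_smul, smul_smul, Finset.prod_range_succ]
    congr 1
    ring

theorem algebraMapInv_pow_strip_zero (h : HasShape c x q u w g r s p) (i m : ℕ) :
    TensorAlgebra.algebraMapInv ((strip (x.coord 0) ^ i) ((c.letterMul (x 0) ^ m) 1)) =
      if m = i then ∏ j ∈ Finset.range m, ∑ k ∈ Finset.range (j + 1), q ^ k else 0 := by
  induction m generalizing i with
  | zero =>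
    rcases i with _ | i
    · simp
    · simp [pow_succ]
  | succ m ih =>
    rcases i with _ | i
    · rw [if_neg (by omega), pow_zero, Module.End.one_apply, pow_succ', Module.End.mul_apply]
      exact c.algebraMapInv_letterMul _ _
    · rw [pow_succ (strip _), Module.End.mul_apply, h.strip_zero_pow_zero_one, map_smul, map_smul,
        ih]
      simp only [add_left_inj, smul_eq_mul, mul_ite, mul_zero]
      rw [Finset.prod_range_succ, mul_comm]

/-- The images under `Γ` of the ordered monomials with nonzero quantum factorials are linearly
independent. -/
theorem linearIndependent_monomials (h : HasShape c x q u w g r s p) (hr : r ≠ 0)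
    (S : Set (ℕ × ℕ)) (hq : ∀ a ∈ S, ∀ j < a.1, ∑ k ∈ Finset.range (j + 1), q ^ k ≠ 0)
    (hp : ∀ a ∈ S, ∀ j < a.2, ∑ k ∈ Finset.range (j + 1), p ^ k ≠ 0) :
    LinearIndependent K fun a : S => (QuantumShuffleAlgebra.ofTensor c).symm
      (c.Γ (TensorAlgebra.ι K (x 0) ^ (a : ℕ × ℕ).1 *
        TensorAlgebra.ι K (x 1) ^ (a : ℕ × ℕ).2)) := by
  simp only [Γ_pow_mul, Γ_pow]
  refine linearIndependent_of_triangular S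
    (fun a => (c.letterMul (x 0) ^ a.1) ((c.letterMul (x 1) ^ a.2) 1))
    (fun a => TensorAlgebra.algebraMapInv.toLinearMap ∘ₗ
      ((strip (x.coord 0) ^ a.1) * (strip (x.coord 1) ^ a.2))) ?_ ?_ ?_
  · intro i j m n hn
    simp [h.pow_strip_one_of_lt m hn]
  · intro i j m hm
    simp [h.pow_strip_one_self, h.algebraMapInv_pow_strip_zero, hm]
  · rintro ⟨m, n⟩ ha
    simp only [LinearMap.comp_apply, Module.End.mul_apply, h.pow_strip_one_self, map_smul,
      AlgHom.toLinearMap_apply, h.algebraMapInv_pow_strip_zero, if_true, smul_eq_mul]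
    refine mul_ne_zero (mul_ne_zero (pow_ne_zero _ (pow_ne_zero _ hr)) ?_) ?_
    · exact Finset.prod_ne_zero_iff.2 fun j hj => hp _ ha j (Finset.mem_range.1 hj)
    · exact Finset.prod_ne_zero_iff.2 fun j hj => hq _ ha j (Finset.mem_range.1 hj)

/-! ### Powers of a generator killed by Γ -/

theorem Γ_pow_zero_eq_zero (h : HasShape c x q u w g r s p) {n : ℕ} (hn : 0 < n)
    (hq : ∑ k ∈ Finset.range n, q ^ k = 0) : c.Γ (TensorAlgebra.ι K (x 0) ^ n) = 0 := by
  obtain ⟨n, rfl⟩ : ∃ k, n = k + 1 := ⟨n - 1, by omega⟩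
  apply (QuantumShuffleAlgebra.ofTensor c).symm.injective
  rw [Γ_pow, LinearEquiv.map_zero]
  apply eq_zero_of_strip x
  · rw [pow_succ', Module.End.mul_apply, algebraMapInv_letterMul]
  · rw [h.strip_zero_pow_zero_one, hq, zero_smul]
  · exact h.strip_one_pow_zero_one _

/-- When g = 0, every term of the Leibniz rule for ∂₁ against x₂ ends in ∂₁, so ∂₁ kills all shuffle
powers of x₂ and only ∂₂ matters. -/
theorem Γ_pow_one_eq_zero (h : HasShape c x q u w 0 r s p) {n : ℕ} (hn : 0 < n)
    (hp : ∑ k ∈ Finset.range n, p ^ k = 0) : c.Γ (TensorAlgebra.ι K (x 1) ^ n) = 0 := by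
  obtain ⟨n, rfl⟩ : ∃ k, n = k + 1 := ⟨n - 1, by omega⟩
  have h0 (n : ℕ) : strip (x.coord 0) ((c.letterMul (x 1) ^ n) 1) = 0 := by
    induction n with
    | zero => simp
    | succ n ih =>
      have := LinearMap.congr_fun h.strip_zero_letterMul_one ((c.letterMul (x 1) ^ n) 1)
      simpa [ih, pow_succ'] using this
  apply (QuantumShuffleAlgebra.ofTensor c).symm.injective
  rw [Γ_pow, LinearEquiv.map_zero]
  apply eq_zero_of_strip x
  · rw [pow_succ', Module.End.mul_apply, algebraMapInv_letterMul]
  · exact h0 _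
  · rw [h.strip_one_pow_one_one, hp, zero_smul]

/-- With g arbitrary, ∂₁ of a power of x₂ need not vanish. But x₁ and x₂ commute under the shuffle
product, which gives ∂₁ x₂ⁿ⁺¹ = g C(n+1, 2) x₁ x₂ⁿ⁻¹, and this vanishes with n + 1 since 2 is
invertible. -/
theorem Γ_pow_one_eq_zero_of_cast (h : HasShape c x q 0 0 g 1 1 1) (h2 : (2 : K) ≠ 0) {n : ℕ}
    (hn : 0 < n) (hp : (n : K) = 0) : c.Γ (TensorAlgebra.ι K (x 1) ^ n) = 0 := by
  have hcomm : Commute (c.letterMul (x 1)) (c.letterMul (x 0)) := by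
    apply letterMul_comm_of_one
    rw [← mul_one (TensorAlgebra.ι K (x 0)), ← mul_one (TensorAlgebra.ι K (x 1)),
      letterMul_ι_mul, letterMul_ι_mul, h.ab, h.ba]
    simp [secondMul_tmul, letterMul_one, add_comm]
  have hB (n : ℕ) : strip (x.coord 1) ((c.letterMul (x 1) ^ (n + 1)) 1) =
      ((n : K) + 1) • (c.letterMul (x 1) ^ n) 1 := by
    simpa using h.strip_one_pow_one_one n
  -- Doubled to avoid the binomial coefficient. At n = 0 the truncated exponent n - 1 is harmless
  -- because the coefficient is zero.
  have hA (n : ℕ) : (2 : K) • strip (x.coord 0) ((c.letterMul (x 1) ^ (n + 1)) 1) =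
      (g * (n + 1) * n) • c.letterMul (x 0) ((c.letterMul (x 1) ^ (n - 1)) 1) := by
    have key (n : ℕ) := LinearMap.congr_fun h.strip_zero_letterMul_one
      ((c.letterMul (x 1) ^ n) 1)
    simp only [Module.End.mul_apply, LinearMap.smul_apply, LinearMap.add_apply, zero_smul,
      zero_add, one_smul] at key
    induction n with
    | zero => simpa using Or.inr (key 0)
    | succ n ih =>
      rw [pow_succ', Module.End.mul_apply, key, smul_add, ← map_smul, ih, map_smul, hB,
        ← Module.End.mul_apply, hcomm.eq, Module.End.mul_apply, map_smul, smul_smul, smul_smul]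
      rcases n with _ | n
      · norm_num [mul_comm]
      · rw [← Module.End.mul_apply (c.letterMul (x 1)), Nat.add_sub_cancel, ← pow_succ',
          Nat.add_sub_cancel, ← add_smul]
        congr 1
        push_cast
        ring
  obtain ⟨n, rfl⟩ : ∃ k, n = k + 1 := ⟨n - 1, by omega⟩
  push_cast at hp
  apply (QuantumShuffleAlgebra.ofTensor c).symm.injective
  rw [Γ_pow, LinearEquiv.map_zero]
  apply eq_zero_of_strip x
  · rw [pow_succ', Module.End.mul_apply, algebraMapInv_letterMul]
  · have := hA n
    rw [hp, mul_zero, zero_mul, zero_smul] at this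
    exact (smul_eq_zero.1 this).resolve_left h2
  · rw [hB, hp, zero_smul]

end HasShape
end Braiding

/-! ### Ordered monomials span the quadratic algebra -/

namespace Braiding

open TensorProduct BraidShuffle

variable {K : Type u} {V : Type v} [Field K] [AddCommGroup V] [Module K V]

theorem mk'_smul (c : Braiding K V) (r : K) (t : TensorAlgebra K V) :
    c.quadraticIdeal.ringCon.mk' (r • t) = r • c.quadraticIdeal.ringCon.mk' t := rfl

theorem quadratic_eq_top (c : Braiding K V) (x : Module.Basis (Fin 2) K V)
    (N : Submodule K c.QuadraticSymmetricAlgebra) (h1 : 1 ∈ N)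
    (h : ∀ i, ∀ y ∈ N, c.quadraticIdeal.ringCon.mk' (TensorAlgebra.ι K (x i)) * y ∈ N) :
    ⊤ ≤ N := by
  intro y _
  obtain ⟨t, rfl⟩ := c.quadraticIdeal.ringCon.mk'_surjective y
  induction t using induction_left with
  | h1 => rwa [map_one]
  | hs r a ha => exact N.smul_mem r (ha trivial)
  | hadd a b ha hb => rw [map_add]; exact N.add_mem (ha trivial) (hb trivial)
  | hι z t ht =>
    have e : c.quadraticIdeal.ringCon.mk' (TensorAlgebra.ι K z * t) =
        x.repr z 0 • (c.quadraticIdeal.ringCon.mk' (TensorAlgebra.ι K (x 0)) *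
          c.quadraticIdeal.ringCon.mk' t) +
        x.repr z 1 • (c.quadraticIdeal.ringCon.mk' (TensorAlgebra.ι K (x 1)) *
          c.quadraticIdeal.ringCon.mk' t) := by
      conv_lhs => rw [← x.sum_repr z, Fin.sum_univ_two, map_add, map_smul, map_smul, add_mul,
        smul_mul_assoc, smul_mul_assoc, map_add]
      rw [← map_mul, ← map_mul]
      rfl
    rw [e]
    exact N.add_mem (N.smul_mem _ (h 0 _ (ht trivial))) (N.smul_mem _ (h 1 _ (ht trivial)))

/-- Moving b past powers of a produces only a further power of a, so normal ordering terminates; the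
exact scalars are irrelevant. -/
theorem mul_pow_eq {R : Type*} [Ring R] [Algebra K R] {a b : R} {κ l : K}
    (h : b * a = κ • (a * b) + l • (a * a)) (m : ℕ) :
    ∃ κ' l' : K, b * a ^ m = κ' • (a ^ m * b) + l' • a ^ (m + 1) := by
  induction m with
  | zero => exact ⟨1, 0, by simp⟩
  | succ m ih =>
    obtain ⟨κ', l', e⟩ := ih
    refine ⟨κ' * κ, κ' * l + l', ?_⟩
    rw [pow_succ, ← mul_assoc, e, add_mul, smul_mul_assoc, smul_mul_assoc, mul_assoc, h, mul_add,
      mul_smul_comm, mul_smul_comm, smul_add, smul_smul, smul_smul, ← mul_assoc, ← mul_assoc,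
      ← pow_succ, ← pow_succ, add_smul, add_assoc]

/-- The set S allows for extra quadratic relations: `hS` asks only that they reduce every ordered
monomial to those indexed by S. -/
theorem top_le_span_monomials (c : Braiding K V) (x : Module.Basis (Fin 2) K V) (κ l : K)
    (hE : x 1 ⊗ₜ x 0 - κ • (x 0 ⊗ₜ x 1) - l • (x 0 ⊗ₜ x 0) ∈ c.E₂) (S : Set (ℕ × ℕ))
    (hS : ∀ m n, c.quadraticIdeal.ringCon.mk' (TensorAlgebra.ι K (x 0)) ^ m *
      c.quadraticIdeal.ringCon.mk' (TensorAlgebra.ι K (x 1)) ^ n ∈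
        Submodule.span K (Set.range fun i : S =>
          c.quadraticIdeal.ringCon.mk' (TensorAlgebra.ι K (x 0) ^ (i : ℕ × ℕ).1 *
            TensorAlgebra.ι K (x 1) ^ (i : ℕ × ℕ).2))) :
    ⊤ ≤ Submodule.span K (Set.range fun i : S =>
      c.quadraticIdeal.ringCon.mk' (TensorAlgebra.ι K (x 0) ^ (i : ℕ × ℕ).1 *
        TensorAlgebra.ι K (x 1) ^ (i : ℕ × ℕ).2)) := by
  have hba : c.quadraticIdeal.ringCon.mk' (TensorAlgebra.ι K (x 1)) *
      c.quadraticIdeal.ringCon.mk' (TensorAlgebra.ι K (x 0)) =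
      κ • (c.quadraticIdeal.ringCon.mk' (TensorAlgebra.ι K (x 0)) *
        c.quadraticIdeal.ringCon.mk' (TensorAlgebra.ι K (x 1))) +
      l • (c.quadraticIdeal.ringCon.mk' (TensorAlgebra.ι K (x 0)) *
        c.quadraticIdeal.ringCon.mk' (TensorAlgebra.ι K (x 0))) := by
    have e := c.mk'_eq_zero_of_mem hE
    rw [map_sub, map_sub, map_sub, map_sub, map_smul (ι₂ K V), map_smul (ι₂ K V), sub_sub,
      sub_eq_zero, mk'_smul, mk'_smul] at e
    simp only [ι₂, LinearMap.comp_apply, TensorProduct.map_tmul, LinearMap.mul'_apply,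
      map_mul] at e
    exact e
  generalize hN : Submodule.span (M := c.QuadraticSymmetricAlgebra) K _ = N at hS ⊢
  refine quadratic_eq_top c x N (by simpa using hS 0 0) fun k y hy => ?_
  rw [← hN] at hy
  induction hy using Submodule.span_induction with
  | zero => rw [mul_zero]; exact N.zero_mem
  | add a b _ _ ha hb => rw [mul_add]; exact N.add_mem ha hb
  | smul r a _ ha => rw [mul_smul_comm]; exact N.smul_mem r ha
  | mem y hy =>
    obtain ⟨⟨⟨m, n⟩, hi⟩, rfl⟩ := hy
    simp only [map_mul, map_pow]
    fin_cases k
    · change c.quadraticIdeal.ringCon.mk' (TensorAlgebra.ι K (x 0)) * _ ∈ N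
      rw [← mul_assoc, ← pow_succ']
      exact hS _ _
    · change c.quadraticIdeal.ringCon.mk' (TensorAlgebra.ι K (x 1)) * _ ∈ N
      obtain ⟨κ', l', e⟩ := mul_pow_eq hba m
      rw [← mul_assoc, e, add_mul, smul_mul_assoc, smul_mul_assoc, mul_assoc, ← pow_succ']
      exact N.add_mem (N.smul_mem _ (hS _ _)) (N.smul_mem _ (hS _ _))

/-! ### Criteria for equality and for its failure -/

namespace HasShape

variable {c : Braiding K V} {x : Module.Basis (Fin 2) K V} {q u w g r s p : K}

theorem symmetricEqNichols_of_geom_sum_ne_zero (h : HasShape c x q u w g r s p) (hr : r ≠ 0)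
    (κ l : K)
    (hE : x 1 ⊗ₜ x 0 - κ • (x 0 ⊗ₜ x 1) - l • (x 0 ⊗ₜ x 0) ∈ c.E₂)
    (hq : ∀ j, ∑ k ∈ Finset.range (j + 1), q ^ k ≠ 0)
    (hp : ∀ j, ∑ k ∈ Finset.range (j + 1), p ^ k ≠ 0) : c.SymmetricEqNichols :=
  c.symmetricEqNichols_of_linearIndependent _
    (top_le_span_monomials c x κ l hE Set.univ fun m n =>
      Submodule.subset_span ⟨⟨(m, n), trivial⟩, by simp⟩)
    (h.linearIndependent_monomials hr Set.univ (fun _ _ _ _ => hq _) fun _ _ _ _ => hp _)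

/-- Meant for q = -1, where [2]_q = 0: the relation x₁² = 0 leaves exponents 0 and 1 of x₁, for
which only [1]_q = 1 is needed. -/
theorem symmetricEqNichols_of_sq_mem (h : HasShape c x q u w g r s p) (hr : r ≠ 0) (κ l : K)
    (hE : x 1 ⊗ₜ x 0 - κ • (x 0 ⊗ₜ x 1) - l • (x 0 ⊗ₜ x 0) ∈ c.E₂)
    (haa : x 0 ⊗ₜ x 0 ∈ c.E₂)
    (hp : ∀ j, ∑ k ∈ Finset.range (j + 1), p ^ k ≠ 0) : c.SymmetricEqNichols := by
  refine c.symmetricEqNichols_of_linearIndependent _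
    (top_le_span_monomials c x κ l hE {a | a.1 < 2} fun m n => ?_)
    (h.linearIndependent_monomials hr _ (fun a ha j hj => ?_) fun _ _ _ _ => hp _)
  · by_cases hm : m < 2
    · exact Submodule.subset_span ⟨⟨(m, n), hm⟩, by simp⟩
    · obtain ⟨m, rfl⟩ : ∃ k, m = k + 2 := ⟨m - 2, by omega⟩
      have e := c.mk'_eq_zero_of_mem haa
      simp only [ι₂, LinearMap.comp_apply, TensorProduct.map_tmul, LinearMap.mul'_apply,
        map_mul] at e
      rw [pow_add, pow_two, e, mul_zero, zero_mul]
      exact Submodule.zero_mem _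
  · obtain rfl : j = 0 := by simp only [Set.mem_ofPred_eq] at ha; omega
    simp

theorem symmetricEqNichols_of_sq_sub_mem (h : HasShape c x q u w g r s p) (hr : r ≠ 0)
    (κ l μ : K) (hE : x 1 ⊗ₜ x 0 - κ • (x 0 ⊗ₜ x 1) - l • (x 0 ⊗ₜ x 0) ∈ c.E₂)
    (hbb : x 1 ⊗ₜ x 1 - μ • (x 0 ⊗ₜ x 0) ∈ c.E₂)
    (hq : ∀ j, ∑ k ∈ Finset.range (j + 1), q ^ k ≠ 0) : c.SymmetricEqNichols := by
  refine c.symmetricEqNichols_of_linearIndependent _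
    (top_le_span_monomials c x κ l hE {a | a.2 < 2} fun m n => ?_)
    (h.linearIndependent_monomials hr _ (fun _ _ _ _ => hq _) fun a ha j hj => ?_)
  -- Replacing x₂² by μ x₁² lowers n but raises m, so m must vary.
  · induction n using Nat.strong_induction_on generalizing m with
    | _ n ih =>
      by_cases hn : n < 2
      · exact Submodule.subset_span ⟨⟨(m, n), hn⟩, by simp⟩
      · obtain ⟨n, rfl⟩ : ∃ k, n = k + 2 := ⟨n - 2, by omega⟩
        have e := c.mk'_eq_zero_of_mem hbb
        rw [map_sub, map_sub, map_smul, sub_eq_zero, mk'_smul] at e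
        simp only [ι₂, LinearMap.comp_apply, TensorProduct.map_tmul, LinearMap.mul'_apply,
          map_mul] at e
        have e2 : c.quadraticIdeal.ringCon.mk' (TensorAlgebra.ι K (x 1)) ^ 2 =
            μ • c.quadraticIdeal.ringCon.mk' (TensorAlgebra.ι K (x 0)) ^ 2 := by
          rw [pow_two, e, pow_two]
        rw [add_comm n 2, pow_add, e2, smul_mul_assoc, mul_smul_comm, ← mul_assoc, ← pow_add]
        exact Submodule.smul_mem _ _ (ih n (by omega) _)
  · obtain rfl : j = 0 := by simp only [Set.mem_ofPred_eq] at ha; omega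
    simp

theorem exists_coeff_of_mem_E₂ (h : HasShape c x q u w g r s p) {z : V ⊗[K] V} (hz : z ∈ c.E₂) :
    ∃ α β δ ε : K, z = α • (x 0 ⊗ₜ x 0) + β • (x 1 ⊗ₜ x 0) + δ • (x 0 ⊗ₜ x 1) +
      ε • (x 1 ⊗ₜ x 1) ∧ (q + 1) * α + u * β + w * δ + g * ε = 0 ∧ β + r * δ = 0 ∧
      δ + s * β = 0 ∧ (p + 1) * ε = 0 := by
  have hz' : c.toLin z + z = 0 := hz
  have e := (x.tensorProduct x).sum_repr z
  simp only [Fintype.sum_prod_type, Fin.sum_univ_two, Module.Basis.tensorProduct_apply] at e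
  generalize (x.tensorProduct x).repr z = l at e
  refine ⟨l (0, 0), l (1, 0), l (0, 1), l (1, 1), by rw [← e]; abel, ?_⟩
  rw [← e] at hz'
  have hc (i : Fin 2 × Fin 2) := DFunLike.congr_fun
    (congrArg (x.tensorProduct x).repr hz') i
  simp only [map_add, map_smul, h.aa, h.ab, h.ba, h.bb, Finsupp.add_apply, Finsupp.smul_apply,
    map_zero, Finsupp.zero_apply, smul_eq_mul] at hc
  have h00 := hc (0, 0)
  have h10 := hc (1, 0)
  have h01 := hc (0, 1)
  have h11 := hc (1, 1)
  simp at h00 h10 h01 h11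
  refine ⟨?_, ?_, ?_, ?_⟩
  · linear_combination h00
  · linear_combination h10
  · linear_combination h01
  · linear_combination h11

/-- The character x₁ ↦ 0, x₂ ↦ 1 sends an element of E₂ to its coefficient ε, which is zero because
p ≠ -1, while it sends x₂ⁿ to 1. -/
theorem not_symmetricEqNichols_of_pow_one (h : HasShape c x q u w g r s p) (hp : p + 1 ≠ 0)
    {n : ℕ} (hΓ : c.Γ (TensorAlgebra.ι K (x 1) ^ n) = 0) :
    ¬ c.SymmetricEqNichols := by
  intro hS
  have := hS.map_eq_zero (TensorAlgebra.lift K (x.constr K ![(0 : K), 1])) (fun z hz => ?_) hΓ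
  · simp at this
  · obtain ⟨α, β, δ, ε, rfl, -, -, -, e⟩ := h.exists_coeff_of_mem_E₂ hz
    simpa [ι₂, Module.Basis.constr_basis, hp] using e

/-- The homomorphism x₁ ↦ 1, x₂ ↦ M kills E₂: the mixed terms cancel since β = -δ, and the squares
contribute α + εμ = 0. It sends x₁ⁿ to 1. -/
theorem not_symmetricEqNichols_of_pow_zero (h : HasShape c x q 0 0 g 1 1 p) {S : Type*} [Ring S]
    [Algebra K S] [Nontrivial S] (M : S) (μ : K) (hM : M * M = μ • 1)
    (hμ : ∀ α ε, (q + 1) * α + g * ε = 0 → (p + 1) * ε = 0 → α + ε * μ = 0)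
    {n : ℕ} (hΓ : c.Γ (TensorAlgebra.ι K (x 0) ^ n) = 0) : ¬ c.SymmetricEqNichols := by
  intro hS
  have := hS.map_eq_zero (TensorAlgebra.lift K (x.constr K ![(1 : S), M])) (fun z hz => ?_) hΓ
  · simp at this
  · obtain ⟨α, β, δ, ε, rfl, e1, e2, -, e3⟩ := h.exists_coeff_of_mem_E₂ hz
    have e4 := hμ α ε (by linear_combination e1) e3
    have e5 : β = -δ := by linear_combination e2
    have : α • (1 : S) + ε • μ • 1 = 0 := by rw [smul_smul, ← add_smul, e4, zero_smul]
    simpa [ι₂, Module.Basis.constr_basis, hM, e5] using this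

end HasShape
end Braiding

/-! ### The eight cases -/

open Braiding in
theorem mainTheorem8 {K : Type u} {V : Type v} [Field K] [AddCommGroup V] [Module K V]
    (hK : ringChar K ≠ 2) (c : Braiding K V) (i : TableCase) (γ : K)
    (hc : TableCase.IsOfCase c i γ) :
    (i ≠ TableCase.case7 → (c.SymmetricEqNichols ↔ ringChar K = 0)) ∧
    (i = TableCase.case7 →
      (c.SymmetricEqNichols ↔ ringChar K = 0 ∧ ¬ ∃ n : ℕ, 0 < n ∧ γ ^ n = 1)) := by
  have h2 : (2 : K) ≠ 0 := Ring.two_ne_zero hK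
  have h2' : (1 : K) + 1 ≠ 0 := by rwa [one_add_one_eq_two]
  obtain ⟨hadm, x, hx⟩ := hc
  have hx0 := hx 0
  have hx1 := hx 1
  have hx2 := hx 2
  have hx3 := hx 3
  clear hx
  have one_sum (h : ringChar K = 0) (j : ℕ) : ∑ k ∈ Finset.range (j + 1), (1 : K) ^ k ≠ 0 := by
    have := (CharP.ringChar_zero_iff_CharZero (R := K)).1 h
    simpa using Nat.cast_add_one_ne_zero (R := K) j
  have zero_sum (j : ℕ) : ∑ k ∈ Finset.range (j + 1), (0 : K) ^ k ≠ 0 := by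
    simp [Finset.sum_range_succ']
  have one_sum_char : ∑ k ∈ Finset.range (ringChar K), (1 : K) ^ k = 0 := by
    simp
  cases i
  all_goals
    simp only [TableCase.tensors, TableCase.matrix, Fin.sum_univ_four, Matrix.of_apply,
      Matrix.cons_val, Matrix.cons_val_zero, Matrix.cons_val_one, zero_smul, zero_add,
      add_zero, one_smul] at hx0 hx1 hx2 hx3
    simp only [TableCase.Admissible] at hadm
    refine ⟨fun h7 => ?_, fun h7 => ?_⟩
    all_goals first | exact absurd rfl h7 | cases h7 | skip
  · have h : HasShape c x 1 0 0 0 1 1 1 :=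
      ⟨by rw [hx0]; module, by rw [hx1]; module, by rw [hx2]; module, by rw [hx3]; module⟩
    refine ⟨fun hS => by_contra fun h0 => ?_, fun h0 => ?_⟩
    · exact h.not_symmetricEqNichols_of_pow_one h2'
        (h.Γ_pow_one_eq_zero (Nat.pos_of_ne_zero h0) one_sum_char) hS
    · exact h.symmetricEqNichols_of_geom_sum_ne_zero one_ne_zero 1 0 (by
        change c.toLin _ + _ = 0
        simp only [map_sub, map_smul, hx0, hx1, hx2]
        module)
        (one_sum h0) (one_sum h0)
  · have h : HasShape c x 1 1 (-1) 0 1 1 1 :=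
      ⟨by rw [hx0]; module, by rw [hx1]; module, by rw [hx2]; module, by rw [hx3]; module⟩
    refine ⟨fun hS => by_contra fun h0 => ?_, fun h0 => ?_⟩
    · exact h.not_symmetricEqNichols_of_pow_one h2'
        (h.Γ_pow_one_eq_zero (Nat.pos_of_ne_zero h0) one_sum_char) hS
    -- The Jordan plane relation x₂x₁ = x₁x₂ + x₁².
    · exact h.symmetricEqNichols_of_geom_sum_ne_zero one_ne_zero 1 1 (by
        change c.toLin _ + _ = 0
        simp only [map_sub, map_smul, hx0, hx1, hx2]
        module)
        (one_sum h0) (one_sum h0)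
  · have h : HasShape c x (-1) 0 0 γ 1 1 1 :=
      ⟨by rw [hx0], by rw [hx1]; module, by rw [hx2]; module, by rw [hx3]; module⟩
    refine ⟨fun hS => by_contra fun h0 => ?_, fun h0 => ?_⟩
    · exact h.not_symmetricEqNichols_of_pow_one h2'
        (h.Γ_pow_one_eq_zero_of_cast h2 (Nat.pos_of_ne_zero h0) ringChar.Nat.cast_ringChar) hS
    · exact h.symmetricEqNichols_of_sq_mem one_ne_zero 1 0 (by
        change c.toLin _ + _ = 0
        simp only [map_sub, map_smul, hx0, hx1, hx2]
        module)
        (by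
        change c.toLin _ + _ = 0
        rw [hx0]
        module) (one_sum h0)
  · have h : HasShape c x 1 0 0 γ 1 1 (-1) :=
      ⟨by rw [hx0]; module, by rw [hx1]; module, by rw [hx2]; module, by rw [hx3]⟩
    refine ⟨fun hS => by_contra fun h0 => ?_, fun h0 => ?_⟩
    -- E₂ contains x₂² - (γ/2) x₁², so x₂ must go to a square root of γ/2. None need exist in K,
    -- hence the companion matrix.
    · exact h.not_symmetricEqNichols_of_pow_zero (S := Matrix (Fin 2) (Fin 2) K)
        !![0, γ / 2; 1, 0] (γ / 2) (by
          ext i j; fin_cases i <;> fin_cases j <;> simp [Matrix.mul_apply])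
        (fun α ε e _ => by
          apply mul_left_cancel₀ h2
          linear_combination e + ε * mul_div_cancel₀ γ h2)
        (h.Γ_pow_zero_eq_zero (Nat.pos_of_ne_zero h0) one_sum_char) hS
    · exact h.symmetricEqNichols_of_sq_sub_mem one_ne_zero 1 0 (γ / 2) (by
        change c.toLin _ + _ = 0
        simp only [map_sub, map_smul, hx0, hx1, hx2]
        module)
        (by
        change c.toLin _ + _ = 0
        simp only [map_sub, map_smul, hx0, hx3]
        match_scalars <;> field_simp <;> ring) (one_sum h0)
  · have h : HasShape c x 0 1 0 0 1 1 1 :=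
      ⟨by rw [hx0]; module, by rw [hx1]; module, by rw [hx2]; module, by rw [hx3]; module⟩
    refine ⟨fun hS => by_contra fun h0 => ?_, fun h0 => ?_⟩
    · exact h.not_symmetricEqNichols_of_pow_one h2'
        (h.Γ_pow_one_eq_zero (Nat.pos_of_ne_zero h0) one_sum_char) hS
    · exact h.symmetricEqNichols_of_geom_sum_ne_zero one_ne_zero 1 1 (by
        change c.toLin _ + _ = 0
        simp only [map_sub, map_smul, hx0, hx1, hx2]
        module)
        zero_sum (one_sum h0)
  · have h : HasShape c x 0 0 0 0 γ γ⁻¹ 1 :=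
      ⟨by rw [hx0]; module, by rw [hx1]; module, by rw [hx2]; module, by rw [hx3]; module⟩
    refine ⟨fun hS => by_contra fun h0 => ?_, fun h0 => ?_⟩
    · exact h.not_symmetricEqNichols_of_pow_one h2'
        (h.Γ_pow_one_eq_zero (Nat.pos_of_ne_zero h0) one_sum_char) hS
    · exact h.symmetricEqNichols_of_geom_sum_ne_zero hadm.1 γ⁻¹ 0 (by
        change c.toLin _ + _ = 0
        simp only [map_sub, map_smul, hx0, hx1, hx2]
        rw [smul_smul, inv_mul_cancel₀ hadm.1]
        module)
        zero_sum (one_sum h0)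
  · have h : HasShape c x γ 0 0 0 1 1 1 :=
      ⟨by rw [hx0], by rw [hx1]; module, by rw [hx2]; module, by rw [hx3]; module⟩
    have hγ : γ + 1 ≠ 0 := fun e => hadm.2 (eq_neg_of_add_eq_zero_left e)
    refine ⟨fun hS => ⟨by_contra fun h0 => ?_, ?_⟩, fun ⟨h0, hn⟩ => ?_⟩
    · exact h.not_symmetricEqNichols_of_pow_one h2'
        (h.Γ_pow_one_eq_zero (Nat.pos_of_ne_zero h0) one_sum_char) hS
    · rintro ⟨n, hn, e⟩
      -- Since γ ≠ -1, no square x₁² occurs in E₂, and x₂ can be sent to 0.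
      exact h.not_symmetricEqNichols_of_pow_zero (S := K) 0 0 (by simp)
        (fun α ε e _ => by simpa [hγ] using e)
        (h.Γ_pow_zero_eq_zero hn (by rw [geom_sum_eq hadm.1, e, sub_self, zero_div])) hS
    · exact h.symmetricEqNichols_of_geom_sum_ne_zero one_ne_zero 1 0 (by
        change c.toLin _ + _ = 0
        simp only [map_sub, map_smul, hx0, hx1, hx2]
        module)
        (fun j e => hn ⟨j + 1, j.succ_pos, by rw [← sub_eq_zero, ← geom_sum_mul, e, zero_mul]⟩)
        (one_sum h0)
  · have h : HasShape c x 1 0 0 γ 1 1 1 :=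
      ⟨by rw [hx0]; module, by rw [hx1]; module, by rw [hx2]; module, by rw [hx3]; module⟩
    refine ⟨fun hS => by_contra fun h0 => ?_, fun h0 => ?_⟩
    -- Powers of x₁ never meet the entry γ. Here q = p = 1 forces ε = 0 and then α = 0 on E₂, so x₂
    -- ↦ 0 works.
    · exact h.not_symmetricEqNichols_of_pow_zero (S := K) 0 0 (by simp)
        (fun α ε e e2 => by
          obtain rfl : ε = 0 := by simpa [h2'] using e2
          simpa [h2'] using e)
        (h.Γ_pow_zero_eq_zero (Nat.pos_of_ne_zero h0) one_sum_char) hS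
    · exact h.symmetricEqNichols_of_geom_sum_ne_zero one_ne_zero 1 0 (by
        change c.toLin _ + _ = 0
        simp only [map_sub, map_smul, hx0, hx1, hx2]
        module)
        (one_sum h0) (one_sum h0)
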